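/- Let $p\in\mathbb{N}_0$. On $T^2\times[0,1]$, with coordinates $x,y\in\mathbb{R}/\mathbb{Z}$ and $z\in[0,1]$, consider the contact form $$\alpha_p=\sin\Bigl(\tfrac{2p+1}{2}\pi z\Bigr)\,\mathrm{d}x+\cos\Bigl(\tfrac{2p+1}{2}\pi z\Bigr)\,\mathrm{d}y .$$ Collapsing the $x$-circles in $T^2\times\{0\}$ and the $y$-circles in $T^2\times\{1\}$ (contact cut) gives the $3$-sphere $S^3=T^2\times[0,1]/\!\sim$, which is identified with the unit sphere in $\mathbb{C}^2$, with its standard orientation and smooth structure, by $[x,y,z]\mapsto(\sqrt{z}\,e^{2\pi\mathrm{i}x},\sqrt{1-z}\,e^{2\pi\mathrm{i}y})$. The form $\alpha_p$ descends to a contact form on $S^3$, still denoted by $\alpha_p$. Let $C_0,C_1\subset S^3$ be the images of the circles $\{\frac12\}\times S^1\times\{0\}$ and $S^1\times\{\frac12\}\times\{1\}$. Then $C_0$ and $C_1$ are unknots (each bounds a smoothly embedded disc) transverse to $\ker\alpha_p$, and their self-linking numbers are $$\mathtt{sl}_{\ker\alpha_p}(C_0)=\mathtt{sl}_{\ker\alpha_p}(C_1)=(-1)^{p+1}.$$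 Here the self-linking number $\mathtt{sl}_{\xi}(K)$ of a knot $K\subset S^3$ transverse to $\xi$ is the linking number of $K$ with its push-off by a sufficiently small positive amount in the direction of a global nowhere vanishing smooth section of $\xi$ (such sections exist, and the statement holds for every choice of the section); the linking number of $K$ with a disjoint closed curve $L$ is the algebraic intersection number of $L$ with a smooth, possibly singular, disc in $S^3$ bounded by $K$ and transverse to $L$. -/

import Mathlib

open scoped Manifold ContDiff

namespace ContactCut

/-- The ambient space `ℝ⁴ = ℂ²`, a point `m` being `(w₁, w₂) = (m 0 + i m 1, m 2 + i m 3)`. -/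
abbrev E4 : Type := EuclideanSpace ℝ (Fin 4)

/-- The standard unit sphere `S³ ⊆ ℂ²`, with Mathlib's smooth structure. -/
abbrev S3 : Type := Metric.sphere (0 : E4) 1

/-! ### The sphere as a quotient of `T² × [0,1]` -/

/-- The ambient expression of the quotient map: `(x, y, z) ↦ (√z e^{2πix}, √(1-z) e^{2πiy})`. -/
noncomputable def cutFun (q : UnitAddCircle × UnitAddCircle × unitInterval) : E4 :=
  !₂[√(q.2.2 : ℝ) * (q.1.toCircle : ℂ).re, √(q.2.2 : ℝ) * (q.1.toCircle : ℂ).im,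
    √(1 - (q.2.2 : ℝ)) * (q.2.1.toCircle : ℂ).re, √(1 - (q.2.2 : ℝ)) * (q.2.1.toCircle : ℂ).im]

theorem circle_sq (c : Circle) : (c : ℂ).re ^ 2 + (c : ℂ).im ^ 2 = 1 := by
  have h := Circle.normSq_coe c
  rw [Complex.normSq_apply] at h
  nlinarith [h]

theorem cutFun_mem (q : UnitAddCircle × UnitAddCircle × unitInterval) :
    cutFun q ∈ Metric.sphere (0 : E4) 1 := by
  obtain ⟨x, y, z, hz0, hz1⟩ := q
  rw [mem_sphere_zero_iff_norm, EuclideanSpace.norm_eq, Real.sqrt_eq_one]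
  have hx := circle_sq x.toCircle
  have hy := circle_sq y.toCircle
  have h0 := Real.sq_sqrt hz0
  have h1 := Real.sq_sqrt (sub_nonneg.2 hz1)
  simp only [cutFun, Fin.sum_univ_four, Real.norm_eq_abs, sq_abs]
  simp only [Matrix.cons_val_zero, Matrix.cons_val_one, Matrix.cons_val, mul_pow, h0, h1]
  linear_combination z * hx + (1 - z) * hy

/-- The quotient map `T² × [0,1] → S³` collapsing the `x`-circles in `{z = 0}` and the
`y`-circles in `{z = 1}`. In the smooth structure of the contact cut, the square of the radial
coordinate near a collapsed torus is (up to a positive smooth factor) the momentum of the collapsed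
circle action, that is `z` near `z = 0` and `1 - z` near `z = 1`; this is why square roots occur. -/
noncomputable def cutMap (q : UnitAddCircle × UnitAddCircle × unitInterval) : S3 :=
  ⟨cutFun q, cutFun_mem q⟩

theorem continuous_cutMap : Continuous cutMap := by
  have hx : Continuous fun q : UnitAddCircle × UnitAddCircle × unitInterval =>
      (q.1.toCircle : ℂ) :=
    continuous_subtype_val.comp (AddCircle.continuous_toCircle.comp continuous_fst)
  have hy : Continuous fun q : UnitAddCircle × UnitAddCircle × unitInterval =>
      (q.2.1.toCircle : ℂ) :=
    continuous_subtype_val.comp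
      (AddCircle.continuous_toCircle.comp (continuous_fst.comp continuous_snd))
  have hz : Continuous fun q : UnitAddCircle × UnitAddCircle × unitInterval => (q.2.2 : ℝ) :=
    continuous_subtype_val.comp (continuous_snd.comp continuous_snd)
  refine Continuous.subtype_mk ?_ _
  refine (PiLp.continuous_toLp 2 _).comp (continuous_pi fun i => ?_)
  have hxr := Complex.continuous_re.comp hx
  have hxi := Complex.continuous_im.comp hx
  have hyr := Complex.continuous_re.comp hy
  have hyi := Complex.continuous_im.comp hy
  have h0 := hz.sqrt
  have h1 := (continuous_const.sub hz : Continuous fun q => (1 : ℝ) - _).sqrt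
  fin_cases i
  · exact h0.mul hxr
  · exact h0.mul hxi
  · exact h1.mul hyr
  · exact h1.mul hyi

theorem exists_polar (a b : ℝ) : ∃ x : UnitAddCircle,
    a = √(a ^ 2 + b ^ 2) * (x.toCircle : ℂ).re ∧ b = √(a ^ 2 + b ^ 2) * (x.toCircle : ℂ).im := by
  obtain ⟨x, hx⟩ : ∃ x : UnitAddCircle, x.toCircle = Circle.exp (Complex.arg ⟨a, b⟩) := by
    refine ⟨((Complex.arg ⟨a, b⟩ / (2 * Real.pi) : ℝ) : UnitAddCircle), ?_⟩
    rw [AddCircle.toCircle_apply_mk]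
    congr 1
    field_simp
  refine ⟨x, ?_⟩
  have hn : ‖(⟨a, b⟩ : ℂ)‖ = √(a ^ 2 + b ^ 2) := by
    rw [Complex.norm_eq_sqrt_sq_add_sq]
  have h := Complex.norm_mul_exp_arg_mul_I ⟨a, b⟩
  rw [hn, ← Circle.coe_exp, ← hx] at h
  have hr := congrArg Complex.re h
  have hi := congrArg Complex.im h
  rw [Complex.re_ofReal_mul] at hr
  rw [Complex.im_ofReal_mul] at hi
  exact ⟨hr.symm, hi.symm⟩

theorem surjective_cutMap : Function.Surjective cutMap := by
  rintro ⟨m, hm⟩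
  have hm' := hm
  rw [mem_sphere_zero_iff_norm, EuclideanSpace.norm_eq, Real.sqrt_eq_one] at hm'
  simp only [Fin.sum_univ_four, Real.norm_eq_abs, sq_abs] at hm'
  obtain ⟨x, hx0, hx1⟩ := exists_polar (m 0) (m 1)
  obtain ⟨y, hy0, hy1⟩ := exists_polar (m 2) (m 3)
  have hz : 1 - (m 0 ^ 2 + m 1 ^ 2) = m 2 ^ 2 + m 3 ^ 2 := by linarith
  refine ⟨(x, y, ⟨m 0 ^ 2 + m 1 ^ 2, by positivity, by nlinarith [sq_nonneg (m 2), sq_nonneg (m 3)]⟩),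
    ?_⟩
  apply Subtype.ext
  ext i
  fin_cases i
  · exact hx0.symm
  · exact hx1.symm
  · simp only [cutMap, cutFun, hz]
    exact hy0.symm
  · simp only [cutMap, cutFun, hz]
    exact hy1.symm

/-- `S³` carries the quotient topology of `T² × [0,1]`. -/
theorem isQuotientMap_cutMap : Topology.IsQuotientMap cutMap :=
  continuous_cutMap.isClosedMap.isQuotientMap continuous_cutMap surjective_cutMap

/-- The identifications made by `cutMap` are exactly those of the cut. -/
theorem cutMap_eq_iff (x y x' y' : UnitAddCircle) (z z' : unitInterval) :
    cutMap (x, y, z) = cutMap (x', y', z') ↔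
      z = z' ∧ (x = x' ∨ z = 0) ∧ (y = y' ∨ z = 1) := by
  have key : ∀ (r : ℝ) (x x' : UnitAddCircle), r * (x.toCircle : ℂ).re = r * (x'.toCircle : ℂ).re →
      r * (x.toCircle : ℂ).im = r * (x'.toCircle : ℂ).im → x = x' ∨ r = 0 := by
    intro r x x' h0 h1
    by_cases hr : r = 0
    · exact Or.inr hr
    · refine Or.inl (AddCircle.injective_toCircle one_ne_zero (Circle.ext (Complex.ext ?_ ?_)))
      · exact mul_left_cancel₀ hr h0
      · exact mul_left_cancel₀ hr h1
  constructor
  · intro h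
    have h' : cutFun (x, y, z) = cutFun (x', y', z') := congrArg Subtype.val h
    have h0 : √(z : ℝ) * (x.toCircle : ℂ).re = √(z' : ℝ) * (x'.toCircle : ℂ).re :=
      congrArg (fun m : E4 => m 0) h'
    have h1 : √(z : ℝ) * (x.toCircle : ℂ).im = √(z' : ℝ) * (x'.toCircle : ℂ).im :=
      congrArg (fun m : E4 => m 1) h'
    have h2 : √(1 - (z : ℝ)) * (y.toCircle : ℂ).re = √(1 - (z' : ℝ)) * (y'.toCircle : ℂ).re :=
      congrArg (fun m : E4 => m 2) h'
    have h3 : √(1 - (z : ℝ)) * (y.toCircle : ℂ).im = √(1 - (z' : ℝ)) * (y'.toCircle : ℂ).im :=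
      congrArg (fun m : E4 => m 3) h'
    have hz : z = z' := by
      apply Subtype.ext
      have e := circle_sq x.toCircle
      have e' := circle_sq x'.toCircle
      have s := Real.sq_sqrt z.2.1
      have s' := Real.sq_sqrt z'.2.1
      have a : (√(z : ℝ) * (x.toCircle : ℂ).re) ^ 2 + (√(z : ℝ) * (x.toCircle : ℂ).im) ^ 2 = z := by
        rw [mul_pow, mul_pow, s, ← mul_add, e, mul_one]
      have a' : (√(z' : ℝ) * (x'.toCircle : ℂ).re) ^ 2 +
          (√(z' : ℝ) * (x'.toCircle : ℂ).im) ^ 2 = z' := by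
        rw [mul_pow, mul_pow, s', ← mul_add, e', mul_one]
      rw [← a, ← a', h0, h1]
    subst hz
    refine ⟨rfl, ?_, ?_⟩
    · refine (key _ x x' h0 h1).imp id fun h => Subtype.ext ?_
      exact (Real.sqrt_eq_zero z.2.1).1 h
    · refine (key _ y y' h2 h3).imp id fun h => Subtype.ext ?_
      have := (Real.sqrt_eq_zero (sub_nonneg.2 z.2.2)).1 h
      show (z : ℝ) = 1
      linarith
  · rintro ⟨rfl, hx, hy⟩
    apply Subtype.ext
    rcases hx with rfl | rfl <;> rcases hy with rfl | hy
    · rfl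
    · subst hy; simp [cutMap, cutFun]
    · simp [cutMap, cutFun]
    · exact absurd hy zero_ne_one

/-! ### The contact forms -/

/-- The coefficient `c = (2p+1)π/2`. -/
noncomputable def freq (p : ℕ) : ℝ := (2 * p + 1) / 2 * Real.pi

/-- The `i`-th coordinate, that is, the constant 1-form `dmᵢ`. -/
noncomputable def coord (i : Fin 4) : E4 →L[ℝ] ℝ := EuclideanSpace.proj i

/-- The 1-form on `S³` (written as the restriction of a form on `ℂ²`) to which
`sin (c z) dx + cos (c z) dy` descends, see `cutForm_pullback`. Here
`m 0 dm₁ - m 1 dm₀ = 2π |w₁|² dx` and `m 2 dm₃ - m 3 dm₂ = 2π |w₂|² dy`, while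
`|w₁|² = z`, `|w₂|² = 1 - z` and `cos (c z) = (-1)^p sin (c (1 - z))`. -/
noncomputable def cutForm (p : ℕ) (m : E4) : E4 →L[ℝ] ℝ :=
  (freq p / (2 * Real.pi) * Real.sinc (freq p * (m 0 ^ 2 + m 1 ^ 2))) •
      (m 0 • coord 1 -
        m 1 • coord 0) +
  ((-1) ^ p * (freq p / (2 * Real.pi)) * Real.sinc (freq p * (m 2 ^ 2 + m 3 ^ 2))) •
      (m 2 • coord 3 -
        m 3 • coord 2)

theorem cos_freq_mul (p : ℕ) (z : ℝ) :
    Real.cos (freq p * z) = (-1) ^ p * Real.sin (freq p * (1 - z)) := by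
  have h : freq p * (1 - z) = (Real.pi / 2 - freq p * z) + p * Real.pi := by
    unfold freq; ring
  rw [h, Real.sin_add_nat_mul_pi, Real.sin_pi_div_two_sub, ← mul_assoc, ← mul_pow]
  simp

/-- On the open part `0 < z < 1` the pullback of `cutForm p` under the quotient map is
`sin (c z) dx + cos (c z) dy`: along any curve `(x, y, z)` its value on the velocity of the image
curve is `sin (c z) x' + cos (c z) y'`. -/
theorem cutForm_pullback (p : ℕ) (x y : ℝ → ℝ) (z : ℝ → unitInterval) (t x' y' z' : ℝ)
    (hx : HasDerivAt x x' t) (hy : HasDerivAt y y' t) (hz : HasDerivAt (fun s => (z s : ℝ)) z' t)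
    (hz0 : 0 < (z t : ℝ)) (hz1 : (z t : ℝ) < 1) :
    ∃ u : E4, HasDerivAt (fun s => (cutMap ((x s : UnitAddCircle), (y s : UnitAddCircle), z s) : E4))
        u t ∧
      cutForm p (cutMap ((x t : UnitAddCircle), (y t : UnitAddCircle), z t)) u =
        Real.sin (freq p * z t) * x' + Real.cos (freq p * z t) * y' := by
  have hre : ∀ s : ℝ, ((AddCircle.toCircle (s : UnitAddCircle) : Circle) : ℂ).re =
      Real.cos (2 * Real.pi * s) := by
    intro s
    rw [AddCircle.toCircle_apply_mk, Circle.coe_exp, Complex.exp_ofReal_mul_I_re]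
    simp
  have him : ∀ s : ℝ, ((AddCircle.toCircle (s : UnitAddCircle) : Circle) : ℂ).im =
      Real.sin (2 * Real.pi * s) := by
    intro s
    rw [AddCircle.toCircle_apply_mk, Circle.coe_exp, Complex.exp_ofReal_mul_I_im]
    simp
  have hz1' : 0 < 1 - (z t : ℝ) := by linarith
  have d0 := hz.sqrt hz0.ne'
  have d1 := (hz.const_sub 1).sqrt hz1'.ne'
  have dcx := (hx.const_mul (2 * Real.pi)).cos
  have dsx := (hx.const_mul (2 * Real.pi)).sin
  have dcy := (hy.const_mul (2 * Real.pi)).cos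
  have dsy := (hy.const_mul (2 * Real.pi)).sin
  let f : ℝ → Fin 4 → ℝ := fun s =>
    ![√(z s : ℝ) * Real.cos (2 * Real.pi * x s), √(z s : ℝ) * Real.sin (2 * Real.pi * x s),
      √(1 - (z s : ℝ)) * Real.cos (2 * Real.pi * y s),
      √(1 - (z s : ℝ)) * Real.sin (2 * Real.pi * y s)]
  have hf : ∀ s, (cutMap ((x s : UnitAddCircle), (y s : UnitAddCircle), z s) : E4) =
      WithLp.toLp 2 (f s) := by
    intro s
    simp only [cutMap, cutFun, f, hre, him]
  obtain ⟨u0, hu0, e0⟩ : ∃ u, u = _ ∧ HasDerivAt _ u t := ⟨_, rfl, d0.fun_mul dcx⟩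
  obtain ⟨u1, hu1, e1⟩ : ∃ u, u = _ ∧ HasDerivAt _ u t := ⟨_, rfl, d0.fun_mul dsx⟩
  obtain ⟨u2, hu2, e2⟩ : ∃ u, u = _ ∧ HasDerivAt _ u t := ⟨_, rfl, d1.fun_mul dcy⟩
  obtain ⟨u3, hu3, e3⟩ : ∃ u, u = _ ∧ HasDerivAt _ u t := ⟨_, rfl, d1.fun_mul dsy⟩
  have hd : HasDerivAt f ![u0, u1, u2, u3] t := by
    refine hasDerivAt_pi.2 fun i => ?_
    fin_cases i
    exacts [e0, e1, e2, e3]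
  refine ⟨WithLp.toLp 2 ![u0, u1, u2, u3], ?_, ?_⟩
  · simp only [hf]
    exact (PiLp.hasFDerivAt_toLp (𝕜 := ℝ) 2 (f t)).comp_hasDerivAt t hd
  · have s0 := Real.sq_sqrt hz0.le
    have s1 := Real.sq_sqrt hz1'.le
    have cx := Real.sin_sq_add_cos_sq (2 * Real.pi * x t)
    have cy := Real.sin_sq_add_cos_sq (2 * Real.pi * y t)
    have hp := Real.pi_pos
    have hc : 0 < freq p := by unfold freq; positivity
    have a0 : f t 0 ^ 2 + f t 1 ^ 2 = z t := by
      show (_ * _) ^ 2 + (_ * _) ^ 2 = _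
      rw [mul_pow, mul_pow, s0]
      linear_combination (z t : ℝ) * cx
    have a1 : f t 2 ^ 2 + f t 3 ^ 2 = 1 - z t := by
      show (_ * _) ^ 2 + (_ * _) ^ 2 = _
      rw [mul_pow, mul_pow, s1]
      linear_combination (1 - (z t : ℝ)) * cy
    have b0 : f t 0 * u1 - f t 1 * u0 = 2 * Real.pi * z t * x' := by
      show (_ * _) * u1 - (_ * _) * u0 = _
      rw [hu0, hu1]
      linear_combination (2 * Real.pi * x') *
        ((Real.sin (2 * Real.pi * x t) ^ 2 + Real.cos (2 * Real.pi * x t) ^ 2) * s0 + z t * cx)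
    have b1 : f t 2 * u3 - f t 3 * u2 = 2 * Real.pi * (1 - z t) * y' := by
      show (_ * _) * u3 - (_ * _) * u2 = _
      rw [hu2, hu3]
      linear_combination (2 * Real.pi * y') *
        ((Real.sin (2 * Real.pi * y t) ^ 2 + Real.cos (2 * Real.pi * y t) ^ 2) * s1 +
          (1 - z t) * cy)
    have hform : cutForm p (WithLp.toLp 2 (f t)) (WithLp.toLp 2 ![u0, u1, u2, u3]) =
        freq p / (2 * Real.pi) * Real.sinc (freq p * (f t 0 ^ 2 + f t 1 ^ 2)) *
          (f t 0 * u1 - f t 1 * u0) +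
        (-1) ^ p * (freq p / (2 * Real.pi)) * Real.sinc (freq p * (f t 2 ^ 2 + f t 3 ^ 2)) *
          (f t 2 * u3 - f t 3 * u2) := rfl
    rw [hf, hform, a0, a1, b0, b1, Real.sinc_of_ne_zero (by positivity),
      Real.sinc_of_ne_zero (by positivity), cos_freq_mul]
    field_simp

/-! ### The two circles -/

/-- The circle `{1/2} × S¹ × {0}`, parametrised by `y`. -/
noncomputable def C0 (t : ℝ) : S3 := cutMap (((1 / 2 : ℝ) : UnitAddCircle), (t : UnitAddCircle), 0)

/-- The circle `S¹ × {1/2} × {1}`, parametrised by `x`. -/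
noncomputable def C1 (t : ℝ) : S3 := cutMap ((t : UnitAddCircle), ((1 / 2 : ℝ) : UnitAddCircle), 1)

/-! ### Linking and self-linking numbers in `S³` -/

/-- A closed curve in `S³` as a curve in the ambient space. -/
def ambient (K : ℝ → S3) (t : ℝ) : E4 := K t

/-- The determinant of four vectors of `ℝ⁴`. For `m ∈ S³` and `a, b, c` tangent to `S³` at `m`,
`orientDet m a b c > 0` means that `(a, b, c)` is positive for the standard orientation of `S³` as
the boundary of the unit ball. -/
noncomputable def orientDet (a b c d : E4) : ℝ :=
  (Matrix.of ![fun i => a i, fun i => b i, fun i => c i, fun i => d i]).det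

/-- `F` restricts to a smooth map of the closed unit disc into `S³` (not necessarily an embedding)
whose boundary is the closed curve `K`, with the boundary orientation. -/
def IsDiscBoundedBy (F : ℂ → E4) (K : ℝ → E4) : Prop :=
  ContDiff ℝ ∞ F ∧ (∀ w ∈ Metric.closedBall (0 : ℂ) 1, F w ∈ Metric.sphere (0 : E4) 1) ∧
    ∀ t : ℝ, F (Complex.exp (2 * Real.pi * t * Complex.I)) = K t

/-- The linking number in `S³` of two disjoint closed curves of period `1` is `n`: it is the
algebraic intersection number of `L` with a disc bounded by `K` to which `L` is transverse.
`I` is the (finite) set of the intersections. The map of the disc may have singularities and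
self-intersections, so every smooth closed curve in `S³` bounds one, and the intersection number
does not depend on it, because `H₂(S³) = 0`. -/
def HasLinkingNumber (K L : ℝ → E4) (n : ℤ) : Prop :=
  (∀ s t, K s ≠ L t) ∧ ∃ F : ℂ → E4, IsDiscBoundedBy F K ∧ ∃ I : Finset (ℂ × ℝ),
    (∀ w t, (w, t) ∈ I ↔ w ∈ Metric.ball (0 : ℂ) 1 ∧ t ∈ Set.Ico (0 : ℝ) 1 ∧ F w = L t) ∧
    (∀ q ∈ I, orientDet (F q.1) (fderiv ℝ F q.1 1) (fderiv ℝ F q.1 Complex.I) (deriv L q.2) ≠ 0) ∧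
    ∑ q ∈ I, (SignType.sign (orientDet (F q.1) (fderiv ℝ F q.1 1) (fderiv ℝ F q.1 Complex.I)
      (deriv L q.2)) : ℤ) = n

/-- `K` is a smooth knot in `S³`, of period `1`. -/
def IsKnot (K : ℝ → S3) : Prop :=
  ContDiff ℝ ∞ (ambient K) ∧ Function.Periodic K 1 ∧ Set.InjOn K (Set.Ico 0 1) ∧
    ∀ t, deriv (ambient K) t ≠ 0

/-- `K` is an unknot: it bounds a smoothly embedded disc. -/
def IsUnknot (K : ℝ → S3) : Prop :=
  IsKnot K ∧ ∃ F : ℂ → E4, IsDiscBoundedBy F (ambient K) ∧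
    Set.InjOn F (Metric.closedBall 0 1) ∧
    ∀ w ∈ Metric.closedBall (0 : ℂ) 1, Function.Injective (fderiv ℝ F w)

/-- `K` is (positively or negatively) transverse to the plane field `ker α` on `S³`. -/
def IsTransverse (α : E4 → E4 →L[ℝ] ℝ) (K : ℝ → S3) : Prop :=
  ∀ t, α (K t) (deriv (ambient K) t) ≠ 0

/-- `v` is a smooth nowhere vanishing section of the plane field `ker α ⊆ TS³`. -/
def IsNonvanishingSection (α : E4 → E4 →L[ℝ] ℝ) (v : S3 → E4) : Prop :=
  ContMDiff (𝓡 3) 𝓘(ℝ, E4) ∞ v ∧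
    ∀ m : S3, inner ℝ (m : E4) (v m) = 0 ∧ α m (v m) = 0 ∧ v m ≠ 0

/-- The push-off of `K` by `ε` in the direction of the vector field `v` on `S³`, that is
`K + ε v` projected radially to the sphere. -/
noncomputable def pushOff (K : ℝ → S3) (v : S3 → E4) (ε : ℝ) (t : ℝ) : E4 :=
  ‖(K t : E4) + ε • v (K t)‖⁻¹ • ((K t : E4) + ε • v (K t))

/-- The knot `K` is transverse to `ξ = ker α` and its self-linking number is `n`. Here `ξ` admits a
global nowhere vanishing section, and for each such section `v` the linking number of `K` with its
push-off in the direction of `v`, by any sufficiently small positive amount, is `n`. -/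
def HasSelfLinkingNumber (α : E4 → E4 →L[ℝ] ℝ) (K : ℝ → S3) (n : ℤ) : Prop :=
  IsKnot K ∧ IsTransverse α K ∧ (∃ v, IsNonvanishingSection α v) ∧
    ∀ v, IsNonvanishingSection α v →
      ∀ᶠ ε in nhdsWithin (0 : ℝ) (Set.Ioi 0), HasLinkingNumber (ambient K) (pushOff K v ε) n

end ContactCut

open scoped Manifold ContDiff

namespace ContactCut

/-! ### Smooth logarithms and the cardinal sine -/

/-! The plane field `ker α_p` is trivialised by two explicit fields `frame₁`, `frame₂`. For even `p`
they start from `(w̄₂, -w̄₁)` and its multiple by `i`, for odd `p` from `(w₂, -w₁)` and `(i w₂, i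
w₁)`; adding multiples of the two rotation fields `(i w₁, 0)` and `(0, i w₂)` moves them into `ker
α_p`. These corrections vanish on both circles. Along `C₀` the plane is the `w₁`-line, and since `w₂
= exp (2πit)` enters conjugated exactly when `p` is even, the frame winds `(-1)^(p+1)` times there.

Every other nowhere vanishing section winds equally often. Its pairing with the frame is a complex
function without zeros (`eq_zero_of_inner_frame`), so over a hemisphere spanning `C₀` this function
has a smooth logarithm `Λ` (`exists_log_section`).

To read the winding number `N = ±1` off as an intersection number, the spanning disc is adapted to
the section: near its boundary `twistedDisc` is rotated in the `w₁`-direction by the phase `Im Λ`.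
Relative to this disc the push-off has phase exactly `2πNt`, so it crosses the disc once, at `t =
0`, with sign `N` (`hasLinkingNumber_twistedCurve`).

The circle `C₁` follows from the swap `(w₁, w₂) ↦ (w₂, w₁)`, which preserves orientation and
multiplies `α_p` by `(-1)^p`. -/

theorem contDiff_sinc {n : WithTop ℕ∞} : ContDiff ℝ n Real.sinc := by
  rw [contDiff_iff_contDiffAt]
  intro x
  by_cases hx : x = 0
  · subst hx
    obtain ⟨q, hq⟩ : AnalyticAt ℝ Real.sin 0 := Real.contDiff_sin.contDiffAt.analyticAt
    rw [Real.sinc_eq_dslope]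
    exact (hq.has_fpower_series_dslope_fslope).analyticAt.contDiffAt
  · have h : (fun y => Real.sin y / y) =ᶠ[nhds x] Real.sinc := by
      filter_upwards [isOpen_ne.mem_nhds hx] with y hy
      exact (Real.sinc_of_ne_zero hy).symm
    exact (Real.contDiff_sin.contDiffAt.div contDiffAt_id hx).congr_of_eventuallyEq h.symm

theorem mul_sinc (x : ℝ) : x * Real.sinc x = Real.sin x := by
  by_cases hx : x = 0
  · simp [hx]
  · rw [Real.sinc_of_ne_zero hx]; field_simp

/-- A continuous logarithm of a smooth function is smooth. -/
theorem contDiff_of_exp_comp {E : Type*} [NormedAddCommGroup E] [NormedSpace ℝ E]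
    {n : WithTop ℕ∞} {Λ Q : E → ℂ} (hΛ : Continuous Λ) (hQ : ContDiff ℝ n Q)
    (h : ∀ w, Complex.exp (Λ w) = Q w) : ContDiff ℝ n Λ := by
  rw [contDiff_iff_contDiffAt]
  intro w₀
  -- The factor `exp (-Λ w₀)` brings the argument of `log` to `1`, away from the cut. Near `w₀` the
  -- imaginary part of `Λ - Λ w₀` stays in `(-π, π)`, so the principal branch recovers `Λ`.
  have hd : ContDiffAt ℝ n (fun w => Complex.log (Q w * Complex.exp (-Λ w₀)) + Λ w₀) w₀ := by
    refine ContDiffAt.add ?_ contDiffAt_const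
    have h1 : Q w₀ * Complex.exp (-Λ w₀) = 1 := by
      rw [← h, ← Complex.exp_add, add_neg_cancel, Complex.exp_zero]
    have hl : ContDiffAt ℝ n Complex.log (Q w₀ * Complex.exp (-Λ w₀)) := by
      rw [h1]
      exact (Complex.contDiffAt_log Complex.one_mem_slitPlane).restrict_scalars ℝ
    exact hl.comp w₀ (hQ.contDiffAt.mul contDiffAt_const)
  refine hd.congr_of_eventuallyEq ?_
  have hc : Filter.Tendsto (fun w => (Λ w - Λ w₀).im) (nhds w₀) (nhds 0) := by
    have : Continuous fun w => (Λ w - Λ w₀).im :=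
      Complex.continuous_im.comp (hΛ.sub continuous_const)
    simpa using this.tendsto w₀
  filter_upwards [hc.eventually (Ioo_mem_nhds (neg_lt_zero.2 Real.pi_pos) Real.pi_pos)] with w hw
  rw [← h, ← Complex.exp_add, ← sub_eq_add_neg, Complex.log_exp hw.1 hw.2.le]
  ring

/-- A nowhere vanishing smooth complex function on a vector space has a smooth logarithm. -/
theorem exists_contDiff_log {E : Type*} [NormedAddCommGroup E] [NormedSpace ℝ E]
    {n : WithTop ℕ∞} {Q : E → ℂ} (hQ : ContDiff ℝ n Q) (h0 : ∀ w, Q w ≠ 0) :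
    ∃ Λ : E → ℂ, ContDiff ℝ n Λ ∧ ∀ w, Complex.exp (Λ w) = Q w := by
  -- A vector space is simply connected, so `Q` lifts through the covering `exp` of the punctured
  -- plane.
  obtain ⟨Λ, ⟨-, hΛ⟩, -⟩ := Complex.isCoveringMapOn_exp.existsUnique_continuousMap_lifts
    (⟨Q, hQ.continuous⟩ : C(E, ℂ)) (a₀ := 0) (e₀ := Complex.log (Q 0))
    (Complex.exp_log (h0 0)) (fun a => h0 a)
  have h : ∀ w, Complex.exp (Λ w) = Q w := fun w => congrFun hΛ w
  exact ⟨Λ, contDiff_of_exp_comp Λ.continuous hQ h, h⟩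

/-- Extend a smooth function from the unit circle to a function on the plane that is constant along
the rays outside the disc of radius `1/2`. -/
noncomputable def radialExtension (Θ : ℂ → ℝ) (w : ℂ) : ℝ :=
  Real.smoothTransition (8 * ‖w‖ ^ 2 - 1) * Θ (‖w‖⁻¹ • w)

/-- The cutoff vanishes for `‖w‖² ≤ 1/8`, which removes the singularity of `w / ‖w‖` at the origin.
-/
theorem contDiff_radialExtension {Θ : ℂ → ℝ} (hΘ : ContDiff ℝ ∞ Θ) :
    ContDiff ℝ ∞ (radialExtension Θ) := by
  rw [contDiff_iff_contDiffAt]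
  intro w
  by_cases hw : w = 0
  · subst hw
    have hz : radialExtension Θ =ᶠ[nhds 0] fun _ => 0 := by
      have hc : Continuous fun w : ℂ => 8 * ‖w‖ ^ 2 - 1 := by fun_prop
      have := hc.tendsto 0
      filter_upwards [this.eventually (Iio_mem_nhds (by simp : _ < (0 : ℝ)))] with w hw
      rw [radialExtension, Real.smoothTransition.zero_of_nonpos (le_of_lt hw), zero_mul]
    exact contDiffAt_const.congr_of_eventuallyEq hz
  · have hn : ContDiffAt ℝ ∞ (fun w : ℂ => ‖w‖) w := contDiffAt_norm ℝ hw
    refine ContDiffAt.mul ?_ ?_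
    · refine Real.smoothTransition.contDiff.contDiffAt.comp w ?_
      exact (contDiffAt_const.mul (hn.pow 2)).sub contDiffAt_const
    · exact hΘ.contDiffAt.comp w ((hn.inv (norm_ne_zero_iff.2 hw)).smul contDiffAt_id)

theorem radialExtension_eq (Θ : ℂ → ℝ) {w u : ℂ} {s : ℝ} (hs : 1 / 2 ≤ s) (hu : ‖u‖ = 1)
    (hw : w = s • u) : radialExtension Θ w = Θ u := by
  have hn : ‖w‖ = s := by
    rw [hw, norm_smul, hu, mul_one, Real.norm_of_nonneg (by linarith)]
  -- `8 s² - 1 ≥ 1` as soon as `s ≥ 1/2`: the cutoff has already reached `1`.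
  rw [radialExtension, hn, Real.smoothTransition.one_of_one_le (by nlinarith), one_mul, hw,
    smul_smul, inv_mul_cancel₀ (by linarith), one_smul]

/-! ### Complex coordinates on `ℝ⁴` -/

/-- The point of `ℝ⁴` with complex coordinates `(a, b)`. -/
noncomputable def point (a b : ℂ) : E4 := !₂[a.re, a.im, b.re, b.im]

@[simp] theorem point_zero (a b : ℂ) : point a b 0 = a.re := rfl
@[simp] theorem point_one (a b : ℂ) : point a b 1 = a.im := rfl
@[simp] theorem point_two (a b : ℂ) : point a b 2 = b.re := rfl
@[simp] theorem point_three (a b : ℂ) : point a b 3 = b.im := rfl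

theorem point_inj {a b a' b' : ℂ} : point a b = point a' b' ↔ a = a' ∧ b = b' := by
  constructor
  · intro h
    exact ⟨Complex.ext (congrArg (fun m : E4 => m 0) h) (congrArg (fun m : E4 => m 1) h),
      Complex.ext (congrArg (fun m : E4 => m 2) h) (congrArg (fun m : E4 => m 3) h)⟩
  · rintro ⟨rfl, rfl⟩; rfl

theorem smul_point (r : ℝ) (a b : ℂ) : r • point a b = point (r * a) (r * b) := by
  ext i; fin_cases i <;> simp

theorem norm_sq_E4 (m : E4) : ‖m‖ ^ 2 = m 0 ^ 2 + m 1 ^ 2 + m 2 ^ 2 + m 3 ^ 2 := by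
  rw [EuclideanSpace.norm_sq_eq, Fin.sum_univ_four]
  simp only [Real.norm_eq_abs, sq_abs]

theorem norm_sq_eq_re_im (a : ℂ) : ‖a‖ ^ 2 = a.re ^ 2 + a.im ^ 2 := by
  rw [Complex.sq_norm, Complex.normSq_apply]; ring

theorem norm_sq_point (a b : ℂ) : ‖point a b‖ ^ 2 = ‖a‖ ^ 2 + ‖b‖ ^ 2 := by
  rw [norm_sq_E4, norm_sq_eq_re_im, norm_sq_eq_re_im]
  simp only [point_zero, point_one, point_two, point_three]; ring

theorem point_mem_sphere {a b : ℂ} (h : ‖a‖ ^ 2 + ‖b‖ ^ 2 = 1) :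
    point a b ∈ Metric.sphere (0 : E4) 1 := by
  rw [mem_sphere_zero_iff_norm, ← sq_eq_sq₀ (norm_nonneg _) zero_le_one, norm_sq_point, h, one_pow]

theorem contDiff_point {E : Type*} [NormedAddCommGroup E] [NormedSpace ℝ E] {n : WithTop ℕ∞}
    {f g : E → ℂ} (hf : ContDiff ℝ n f) (hg : ContDiff ℝ n g) :
    ContDiff ℝ n fun w => point (f w) (g w) := by
  rw [contDiff_euclidean]
  intro i
  fin_cases i
  · exact Complex.reCLM.contDiff.comp hf
  · exact Complex.imCLM.contDiff.comp hf
  · exact Complex.reCLM.contDiff.comp hg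
  · exact Complex.imCLM.contDiff.comp hg

theorem hasDerivAt_point {f g : ℝ → ℂ} {f' g' : ℂ} {t : ℝ} (hf : HasDerivAt f f' t)
    (hg : HasDerivAt g g' t) : HasDerivAt (fun s => point (f s) (g s)) (point f' g') t := by
  have h : HasDerivAt (fun s => ![(f s).re, (f s).im, (g s).re, (g s).im])
      ![f'.re, f'.im, g'.re, g'.im] t := by
    refine hasDerivAt_pi.2 fun i => ?_
    fin_cases i
    · exact Complex.reCLM.hasFDerivAt.comp_hasDerivAt t hf
    · exact Complex.imCLM.hasFDerivAt.comp_hasDerivAt t hf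
    · exact Complex.reCLM.hasFDerivAt.comp_hasDerivAt t hg
    · exact Complex.imCLM.hasFDerivAt.comp_hasDerivAt t hg
  exact (PiLp.hasFDerivAt_toLp (𝕜 := ℝ) 2 _).comp_hasDerivAt t h

theorem orientDet_point (a₁ b₁ a₂ b₂ a₃ b₃ a₄ b₄ : ℂ) :
    orientDet (point a₁ b₁) (point a₂ b₂) (point a₃ b₃) (point a₄ b₄) =
      Matrix.det !![a₁.re, a₁.im, b₁.re, b₁.im; a₂.re, a₂.im, b₂.re, b₂.im;
        a₃.re, a₃.im, b₃.re, b₃.im; a₄.re, a₄.im, b₄.re, b₄.im] := by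
  rw [orientDet]
  congr 1

theorem norm_exp_circle (t : ℝ) : ‖Complex.exp (2 * Real.pi * t * Complex.I)‖ = 1 := by
  have := Complex.norm_exp_ofReal_mul_I (2 * Real.pi * t)
  push_cast at this; exact this

theorem contDiff_exp_circle {n : WithTop ℕ∞} :
    ContDiff ℝ n fun t : ℝ => Complex.exp (2 * Real.pi * t * Complex.I) := by
  refine ContDiff.cexp ?_
  exact (contDiff_const.mul Complex.ofRealCLM.contDiff).mul contDiff_const

theorem hasDerivAt_exp_circle (t : ℝ) :
    HasDerivAt (fun t : ℝ => Complex.exp (2 * Real.pi * t * Complex.I))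
      (Complex.exp (2 * Real.pi * t * Complex.I) * (2 * Real.pi * Complex.I)) t := by
  have h : HasDerivAt (fun t : ℝ => 2 * Real.pi * (t : ℂ) * Complex.I) (2 * Real.pi * Complex.I) t := by
    have := ((Complex.ofRealCLM.hasDerivAt (x := t)).const_mul (2 * Real.pi : ℂ)).mul_const Complex.I
    simpa using this
  exact h.cexp

/-! ### A disc with prescribed twisting near its boundary -/

/-- A disc in `S³` bounded by `{0} × S¹`. Outside the disc of radius `1/2`, the argument of its
first coordinate is prescribed by the function `Θ` on the unit circle. -/
noncomputable def twistedDisc (Θ : ℂ → ℝ) (w : ℂ) : E4 :=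
  point (((1 - ‖w‖ ^ 2) / (1 + ‖w‖ ^ 2) : ℝ) * Complex.exp (radialExtension Θ w * Complex.I))
    ((2 / (1 + ‖w‖ ^ 2) : ℝ) * w)

theorem one_add_norm_sq_ne_zero (w : ℂ) : 1 + ‖w‖ ^ 2 ≠ 0 := by positivity

theorem contDiff_twistedDisc {Θ : ℂ → ℝ} (hΘ : ContDiff ℝ ∞ Θ) :
    ContDiff ℝ ∞ (twistedDisc Θ) := by
  have hn : ContDiff ℝ ∞ fun w : ℂ => ‖w‖ ^ 2 := contDiff_norm_sq ℝ
  refine contDiff_point ?_ ?_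
  · refine ContDiff.mul (Complex.ofRealCLM.contDiff.comp ?_) ?_
    · exact (contDiff_const.sub hn).div (contDiff_const.add hn) one_add_norm_sq_ne_zero
    · exact ((Complex.ofRealCLM.contDiff.comp (contDiff_radialExtension hΘ)).mul
        contDiff_const).cexp
  · refine ContDiff.mul (Complex.ofRealCLM.contDiff.comp ?_) contDiff_id
    exact contDiff_const.div (contDiff_const.add hn) one_add_norm_sq_ne_zero

theorem twistedDisc_mem_sphere (Θ : ℂ → ℝ) (w : ℂ) :
    twistedDisc Θ w ∈ Metric.sphere (0 : E4) 1 := by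
  refine point_mem_sphere ?_
  rw [norm_mul, norm_mul, Complex.norm_exp_ofReal_mul_I, mul_one, mul_pow, Complex.norm_real,
    Complex.norm_real, Real.norm_eq_abs, Real.norm_eq_abs, sq_abs, sq_abs]
  field_simp
  ring

theorem isDiscBoundedBy_twistedDisc {Θ : ℂ → ℝ} (hΘ : ContDiff ℝ ∞ Θ) :
    IsDiscBoundedBy (twistedDisc Θ)
      fun t => point 0 (Complex.exp (2 * Real.pi * t * Complex.I)) := by
  refine ⟨contDiff_twistedDisc hΘ, fun w _ => twistedDisc_mem_sphere Θ w, fun t => ?_⟩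
  rw [twistedDisc, norm_exp_circle]
  norm_num

/-- On the outer annulus the moduli follow the rational parametrisation of the unit circle by `s`,
while the phases depend on `u` alone. -/
theorem twistedDisc_polar (Θ : ℂ → ℝ) {s : ℝ} (hs : 1 / 2 ≤ s) {u : ℂ} (hu : ‖u‖ = 1) :
    twistedDisc Θ (s * u) =
      point (((1 - s ^ 2) / (1 + s ^ 2) : ℝ) * Complex.exp (Θ u * Complex.I))
        ((2 * s / (1 + s ^ 2) : ℝ) * u) := by
  have hn : ‖(s : ℂ) * u‖ = s := by
    rw [norm_mul, hu, mul_one, Complex.norm_real, Real.norm_of_nonneg (by linarith)]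
  rw [twistedDisc, hn, radialExtension_eq Θ hs hu (Complex.real_smul).symm]
  congr 1
  push_cast
  ring

theorem twistedDisc_ofReal (Θ : ℂ → ℝ) {s : ℝ} (hs : 1 / 2 ≤ s) :
    twistedDisc Θ s =
      point (((1 - s ^ 2) / (1 + s ^ 2) : ℝ) * Complex.exp (Θ 1 * Complex.I))
        ((2 * s / (1 + s ^ 2) : ℝ) * 1) := by
  rw [← twistedDisc_polar Θ hs norm_one, mul_one]

/-- A twisting curve around `{0} × S¹`. -/
noncomputable def twistedCurve (N : ℤ) (Θ : ℂ → ℝ) (σ ψ : ℝ → ℝ) (t : ℝ) : E4 :=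
  point (σ t * Complex.exp (((2 * Real.pi * (N * t) +
      Θ (Complex.exp (2 * Real.pi * t * Complex.I)) : ℝ) : ℂ) * Complex.I))
    (ψ t * Complex.exp (2 * Real.pi * t * Complex.I))

/-- Subtracting `2πs` times the angular derivative of the disc from the velocity of the curve
cancels `θ'` and leaves `2πN` times the rotation in `w₁`, plus a term in `σ'`, `ψ'`. That term lies
in the plane spanned by the position and the radial derivative, so it does not affect the
determinant. Only the relative twist `N` survives. -/
theorem orientDet_twisted (N : ℤ) {Θ : ℂ → ℝ} (hΘ : ContDiff ℝ ∞ Θ) {σ ψ : ℝ → ℝ}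
    (hσ : DifferentiableAt ℝ σ 0) (hψ : DifferentiableAt ℝ ψ 0) {s : ℝ} (hs : 1 / 2 < s)
    (hσs : σ 0 = (1 - s ^ 2) / (1 + s ^ 2)) (hψs : ψ 0 = 2 * s / (1 + s ^ 2)) :
    orientDet (twistedDisc Θ s) (fderiv ℝ (twistedDisc Θ) s 1)
      (fderiv ℝ (twistedDisc Θ) s Complex.I) (deriv (twistedCurve N Θ σ ψ) 0) =
    N * (8 * Real.pi * (1 - s ^ 2) / (1 + s ^ 2) ^ 3) := by
  have hs0 : 0 < s := by linarith
  have hq : (1 + s ^ 2) ≠ 0 := by positivity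
  set θ : ℝ → ℝ := fun τ => Θ (Complex.exp (2 * Real.pi * τ * Complex.I)) with hθ
  have hθd : DifferentiableAt ℝ θ 0 :=
    ((hΘ.comp contDiff_exp_circle).differentiable (by simp)).differentiableAt
  obtain ⟨θ', hθ'⟩ : ∃ θ', HasDerivAt θ θ' 0 := ⟨_, hθd.hasDerivAt⟩
  have hcir := hasDerivAt_exp_circle 0
  have he0 : Complex.exp (2 * Real.pi * (0 : ℝ) * Complex.I) = 1 := by simp
  have hθ0 : Θ 1 = θ 0 := by rw [hθ]; simp
  have hdiff : HasFDerivAt (twistedDisc Θ) (fderiv ℝ (twistedDisc Θ) s) s :=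
    ((contDiff_twistedDisc hΘ).differentiable (by simp)).differentiableAt.hasFDerivAt
  -- the radial derivative
  have hg : HasDerivAt (fun r : ℝ => (1 - r ^ 2) / (1 + r ^ 2)) (-4 * s / (1 + s ^ 2) ^ 2) s := by
    refine (((hasDerivAt_pow 2 s).const_sub 1).fun_div
      ((hasDerivAt_pow 2 s).const_add 1) hq).congr_deriv ?_
    field_simp
    ring
  have hh : HasDerivAt (fun r : ℝ => 2 * r / (1 + r ^ 2)) (2 * (1 - s ^ 2) / (1 + s ^ 2) ^ 2) s := by
    refine (((hasDerivAt_id' s).const_mul 2).fun_div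
      ((hasDerivAt_pow 2 s).const_add 1) hq).congr_deriv ?_
    field_simp
    ring
  have hA : fderiv ℝ (twistedDisc Θ) s 1 =
      point ((-4 * s / (1 + s ^ 2) ^ 2 : ℝ) * Complex.exp (Θ 1 * Complex.I))
        ((2 * (1 - s ^ 2) / (1 + s ^ 2) ^ 2 : ℝ) * 1) := by
    have h1 : HasDerivAt (fun r : ℝ => twistedDisc Θ r) (fderiv ℝ (twistedDisc Θ) s 1) s :=
      hdiff.comp_hasDerivAt s (HasDerivAt.ofReal_comp (hasDerivAt_id' s))
    refine h1.unique ?_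
    refine (hasDerivAt_point (hg.ofReal_comp.mul_const (Complex.exp (Θ 1 * Complex.I)))
      (hh.ofReal_comp.mul_const 1)).congr_of_eventuallyEq ?_
    filter_upwards [lt_mem_nhds hs] with r hr
    exact twistedDisc_ofReal Θ hr.le
  -- the angular derivative
  have hB : (2 * Real.pi * s) • fderiv ℝ (twistedDisc Θ) s Complex.I =
      point (((1 - s ^ 2) / (1 + s ^ 2) : ℝ) *
          (Complex.exp (θ 0 * Complex.I) * (θ' * Complex.I)))
        ((2 * s / (1 + s ^ 2) : ℝ) * (2 * Real.pi * Complex.I)) := by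
    have h1 : HasDerivAt
        (fun τ : ℝ => twistedDisc Θ (s * Complex.exp (2 * Real.pi * τ * Complex.I)))
        (fderiv ℝ (twistedDisc Θ) s (s * (2 * Real.pi * Complex.I))) 0 := by
      have h2 := hcir.const_mul (s : ℂ)
      rw [he0, one_mul] at h2
      have hdiff' : HasFDerivAt (twistedDisc Θ) (fderiv ℝ (twistedDisc Θ) s)
          (s * Complex.exp (2 * Real.pi * (0 : ℝ) * Complex.I)) := by
        rw [he0, mul_one]
        exact hdiff
      exact hdiff'.comp_hasDerivAt 0 h2
    have h3 : (s : ℂ) * (2 * Real.pi * Complex.I) = (2 * Real.pi * s) • Complex.I := by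
      rw [Complex.real_smul]; push_cast; ring
    rw [h3, map_smul] at h1
    refine h1.unique ?_
    have h4 : HasDerivAt (fun τ => Complex.exp ((θ τ : ℝ) * Complex.I))
        (Complex.exp (θ 0 * Complex.I) * (θ' * Complex.I)) 0 :=
      (hθ'.ofReal_comp.mul_const Complex.I).cexp
    rw [he0, one_mul] at hcir
    refine (hasDerivAt_point (h4.const_mul _) (hcir.const_mul _)).congr_of_eventuallyEq ?_
    filter_upwards with τ
    exact twistedDisc_polar Θ hs.le (norm_exp_circle τ)
  -- the derivative of the curve
  have hL : deriv (twistedCurve N Θ σ ψ) 0 =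
      point ((deriv σ 0 : ℝ) * Complex.exp (θ 0 * Complex.I) + (σ 0 : ℝ) *
          (Complex.exp (θ 0 * Complex.I) * (((2 * Real.pi * N + θ' : ℝ) : ℂ) * Complex.I)))
        ((deriv ψ 0 : ℝ) * 1 + (ψ 0 : ℝ) * (2 * Real.pi * Complex.I)) := by
    rw [he0, one_mul] at hcir
    have h5 : HasDerivAt (fun τ : ℝ => 2 * Real.pi * (N * τ) + θ τ) (2 * Real.pi * N + θ') 0 := by
      refine ((((hasDerivAt_id' (0 : ℝ)).const_mul (N : ℝ)).const_mul
        (2 * Real.pi)).fun_add hθ').congr_deriv ?_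
      ring
    have h6 : HasDerivAt
        (fun τ : ℝ => Complex.exp (((2 * Real.pi * (N * τ) + θ τ : ℝ) : ℂ) * Complex.I))
        (Complex.exp (θ 0 * Complex.I) * (((2 * Real.pi * N + θ' : ℝ) : ℂ) * Complex.I)) 0 := by
      have := (h5.ofReal_comp.mul_const Complex.I).cexp
      simpa using this
    have h7 := hσ.hasDerivAt.ofReal_comp.fun_mul h6
    have h8 := hψ.hasDerivAt.ofReal_comp.fun_mul hcir
    have h9 := (hasDerivAt_point h7 h8).deriv
    simp only [mul_zero, zero_add, he0] at h9
    exact h9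
  have hB' : fderiv ℝ (twistedDisc Θ) s Complex.I = (2 * Real.pi * s)⁻¹ •
      point (((1 - s ^ 2) / (1 + s ^ 2) : ℝ) *
          (Complex.exp (θ 0 * Complex.I) * (θ' * Complex.I)))
        ((2 * s / (1 + s ^ 2) : ℝ) * (2 * Real.pi * Complex.I)) := by
    rw [← hB, smul_smul, inv_mul_cancel₀ (by positivity), one_smul]
  have hcs := Real.cos_sq_add_sin_sq (θ 0)
  rw [twistedDisc_ofReal Θ hs.le, hA, hB', hL, smul_point, orientDet_point, hσs, hψs, hθ0,
    Complex.exp_mul_I,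
    ← Complex.ofReal_cos, ← Complex.ofReal_sin]
  generalize Real.cos (θ 0) = c at *
  generalize Real.sin (θ 0) = d at *
  generalize deriv σ 0 = σ'
  generalize deriv ψ 0 = ψ'
  have hpi := Real.pi_ne_zero
  simp [Matrix.det_succ_row_zero, Fin.sum_univ_succ, Fin.succAbove, -Complex.ofReal_div, Complex.ofReal_re]
  field_simp
  linear_combination ((1 - s ^ 2) * (1 + s ^ 2) ^ 2 * Real.pi * N * 8) * hcs

/-- Moduli fix `‖w‖`, and the phase of the second coordinate then fixes `w = ‖w‖ exp (2πit)`. The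
common phase `Θ` cancels from the first coordinates, leaving `exp (2πiNt) = 1`. -/
theorem twistedDisc_eq_twistedCurve {N : ℤ} (hN : N = 1 ∨ N = -1) (Θ : ℂ → ℝ) {σ ψ : ℝ → ℝ} {t : ℝ}
    (ht : t ∈ Set.Ico (0 : ℝ) 1) (hσ0 : 0 < σ t) (hσ1 : σ t < 3 / 5) (hψ0 : 0 < ψ t)
    {w : ℂ} (hw : ‖w‖ < 1) (h : twistedDisc Θ w = twistedCurve N Θ σ ψ t) :
    t = 0 ∧ w = ((ψ 0 / (1 + σ 0) : ℝ) : ℂ) := by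
  set s := ‖w‖ with hs
  have hs0 : 0 ≤ s := norm_nonneg w
  have hq : (0 : ℝ) < 1 + s ^ 2 := by positivity
  obtain ⟨h1, h2⟩ := point_inj.1 h
  rw [← hs] at h1 h2
  have n2 : 2 * s / (1 + s ^ 2) = ψ t := by
    have := congrArg norm h2
    rw [norm_mul, norm_mul, norm_exp_circle, mul_one, Complex.norm_real, Complex.norm_real,
      Real.norm_of_nonneg hψ0.le, Real.norm_of_nonneg (by positivity), ← hs] at this
    rw [← this]; ring
  have n1 : (1 - s ^ 2) / (1 + s ^ 2) = σ t := by
    have := congrArg norm h1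
    rwa [norm_mul, norm_mul, Complex.norm_exp_ofReal_mul_I, Complex.norm_exp_ofReal_mul_I, mul_one,
      mul_one, Complex.norm_real, Complex.norm_real, Real.norm_of_nonneg hσ0.le,
      Real.norm_of_nonneg (div_nonneg (by nlinarith) hq.le)] at this
  -- The profile `(1 - s²) / (1 + s²)` decreases and equals `3/5` at `s = 1/2`; the bound on `σ`
  -- thus keeps the intersection where the twist is exact.
  have hs2 : 1 / 2 < s := by
    rw [← n1, div_lt_iff₀ hq] at hσ1
    nlinarith
  have hwp : w = s * Complex.exp (2 * Real.pi * t * Complex.I) := by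
    have hne : ((2 / (1 + s ^ 2) : ℝ) : ℂ) ≠ 0 := by
      rw [Complex.ofReal_ne_zero]; positivity
    apply mul_left_cancel₀ hne
    rw [h2, ← n2]
    push_cast
    ring
  rw [hwp, twistedDisc_polar Θ hs2.le (norm_exp_circle t), n1, n2] at h
  have h3 := mul_left_cancel₀ (Complex.ofReal_ne_zero.2 hσ0.ne') (point_inj.1 h).1
  obtain ⟨k, hk⟩ := Complex.exp_eq_exp_iff_exists_int.1 h3
  have hk' : -(N : ℝ) * t = k := by
    have h4 := congrArg Complex.im hk
    simp at h4
    have : 2 * Real.pi * (-(N : ℝ) * t - k) = 0 := by linear_combination h4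
    have := (mul_eq_zero.1 this).resolve_left (by positivity)
    linarith
  -- As `N` is a unit, `t` itself is an integer.
  have ht0 : t = 0 := by
    obtain ⟨l, hl⟩ : ∃ l : ℤ, t = l := by
      rcases hN with rfl | rfl
      · exact ⟨-k, by push_cast at hk' ⊢; linarith⟩
      · exact ⟨k, by push_cast at hk' ⊢; linarith⟩
    rw [hl] at ht ⊢
    have h0 : (0 : ℤ) ≤ l := by exact_mod_cast ht.1
    have h1 : l < (1 : ℤ) := by exact_mod_cast ht.2
    have : l = 0 := by omega
    simp [this]
  subst ht0
  refine ⟨rfl, ?_⟩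
  rw [hwp, ← n1, ← n2]
  have : 2 * s / (1 + s ^ 2) / (1 + (1 - s ^ 2) / (1 + s ^ 2)) = s := by field_simp; ring
  rw [this]
  simp

theorem hasLinkingNumber_twistedCurve {N : ℤ} (hN : N = 1 ∨ N = -1) {Θ : ℂ → ℝ}
    (hΘ : ContDiff ℝ ∞ Θ) {σ ψ : ℝ → ℝ} (hσ : DifferentiableAt ℝ σ 0)
    (hψ : DifferentiableAt ℝ ψ 0) (hσ0 : ∀ t, 0 < σ t) (hσ1 : ∀ t, σ t < 3 / 5)
    (hψ0 : ∀ t, 0 < ψ t) (hσψ : ∀ t, σ t ^ 2 + ψ t ^ 2 = 1) :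
    HasLinkingNumber (fun t => point 0 (Complex.exp (2 * Real.pi * t * Complex.I)))
      (twistedCurve N Θ σ ψ) N := by
  -- The half-angle formula inverts the parametrisation `((1 - s²) / (1 + s²), 2s / (1 + s²)) = (σ
  -- 0, ψ 0)`.
  set s : ℝ := ψ 0 / (1 + σ 0) with hs
  have a0 := hσ0 0
  have a1 := hσ1 0
  have b0 := hψ0 0
  have ab := hσψ 0
  have hs2 : s ^ 2 = (1 - σ 0) / (1 + σ 0) := by
    rw [hs, div_pow, div_eq_div_iff (by positivity) (by positivity)]
    linear_combination (1 + σ 0) * ab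
  have hs1 : 1 / 2 < s := by
    rw [hs, lt_div_iff₀ (by linarith)]
    nlinarith
  have hs3 : s < 1 := by
    rw [hs, div_lt_one (by linarith)]
    nlinarith
  have hσs : σ 0 = (1 - s ^ 2) / (1 + s ^ 2) := by
    rw [hs2]
    field_simp
    ring
  have hψs : ψ 0 = 2 * s / (1 + s ^ 2) := by
    rw [hs2, hs]
    field_simp
    ring
  have hdet := orientDet_twisted N hΘ hσ hψ hs1 hσs hψs
  have hpos : 0 < 8 * Real.pi * (1 - s ^ 2) / (1 + s ^ 2) ^ 3 := by
    have := Real.pi_pos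
    have : 0 < 1 - s ^ 2 := by nlinarith
    positivity
  refine ⟨fun r t h => ?_, twistedDisc Θ, isDiscBoundedBy_twistedDisc hΘ,
    {((s : ℂ), (0 : ℝ))}, fun w t => ?_, ?_, ?_⟩
  · have h1 := (point_inj.1 h).1
    rw [eq_comm, mul_eq_zero, or_iff_left (Complex.exp_ne_zero _), Complex.ofReal_eq_zero] at h1
    exact (hσ0 t).ne' h1
  · rw [Finset.mem_singleton, Prod.mk.injEq, mem_ball_zero_iff]
    constructor
    · rintro ⟨rfl, rfl⟩
      refine ⟨?_, ⟨le_rfl, zero_lt_one⟩, ?_⟩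
      · rw [Complex.norm_real, Real.norm_of_nonneg (by linarith)]
        exact hs3
      · rw [twistedDisc_ofReal Θ hs1.le, ← hσs, ← hψs, twistedCurve]
        simp
    · rintro ⟨hw, ht, h⟩
      obtain ⟨rfl, rfl⟩ := twistedDisc_eq_twistedCurve hN Θ ht (hσ0 t) (hσ1 t) (hψ0 t) hw h
      exact ⟨rfl, rfl⟩
  · intro q hq
    rw [Finset.mem_singleton.1 hq, hdet]
    refine mul_ne_zero ?_ hpos.ne'
    rcases hN with rfl | rfl <;> norm_num
  · rw [Finset.sum_singleton, hdet]
    rcases hN with rfl | rfl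
    · rw [Int.cast_one, one_mul, sign_pos hpos]; rfl
    · rw [Int.cast_neg, Int.cast_one, neg_one_mul, Left.sign_neg, sign_pos hpos]; rfl

/-! ### A global frame of the contact structure -/

/-- `z = |w₁|²`. -/
noncomputable def radA (m : E4) : ℝ := m 0 ^ 2 + m 1 ^ 2

/-- `1 - z = |w₂|²`. -/
noncomputable def radB (m : E4) : ℝ := m 2 ^ 2 + m 3 ^ 2

/-- The smooth extension of `sin (c z) / z`. -/
noncomputable def coeffA (p : ℕ) (m : E4) : ℝ := freq p * Real.sinc (freq p * radA m)

/-- The smooth extension of `cos (c z) / (1 - z)`. -/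
noncomputable def coeffB (p : ℕ) (m : E4) : ℝ := (-1) ^ p * (freq p * Real.sinc (freq p * radB m))

/-- The smooth extension of `(coeffB - 1) / z`. -/
noncomputable def corrA (p : ℕ) (m : E4) : ℝ :=
  coeffB p m - freq p ^ 2 * radA m / 2 * Real.sinc (freq p * radA m / 2) ^ 2

/-- The smooth extension of `((-1)^p coeffA - 1) / (1 - z)`. -/
noncomputable def corrB (p : ℕ) (m : E4) : ℝ :=
  (-1) ^ p * coeffA p m - freq p ^ 2 * radB m / 2 * Real.sinc (freq p * radB m / 2) ^ 2

theorem radA_add_radB {m : E4} (hm : m ∈ Metric.sphere (0 : E4) 1) : radA m + radB m = 1 := by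
  have h := norm_sq_E4 m
  rw [mem_sphere_zero_iff_norm.1 hm, one_pow] at h
  rw [h, radA, radB]; ring

theorem neg_one_pow_mul_self (p : ℕ) : ((-1 : ℝ) ^ p) * (-1) ^ p = 1 := by
  rw [← mul_pow]; simp

theorem coeffA_mul_radA (p : ℕ) (m : E4) : coeffA p m * radA m = Real.sin (freq p * radA m) := by
  rw [← mul_sinc, coeffA]; ring

theorem coeffB_mul_radB (p : ℕ) {m : E4} (hm : m ∈ Metric.sphere (0 : E4) 1) :
    coeffB p m * radB m = Real.cos (freq p * radA m) := by
  have h : 1 - radA m = radB m := by linarith [radA_add_radB hm]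
  rw [cos_freq_mul, h, ← mul_sinc, coeffB]; ring

/-- The half-angle formula, in a form that makes `1 - cos x` divisible by `x` with smooth quotient;
this gives `corrA` and `corrB` their shape. -/
theorem cos_eq_one_sub_sinc (x : ℝ) : Real.cos x = 1 - x ^ 2 / 2 * Real.sinc (x / 2) ^ 2 := by
  have h := Real.cos_two_mul (x / 2)
  rw [mul_div_cancel₀ x two_ne_zero] at h
  have h1 := Real.sin_sq_add_cos_sq (x / 2)
  have h2 := mul_sinc (x / 2)
  rw [← h2] at h1
  linear_combination h + 2 * h1

/-- From `coeffB (1 - z) = cos (c z)` one gets `coeffB - 1 = z coeffB - (1 - cos (c z))`, where both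
terms are divisible by `z`. -/
theorem corrA_spec (p : ℕ) {m : E4} (hm : m ∈ Metric.sphere (0 : E4) 1) :
    radA m * corrA p m = coeffB p m - 1 := by
  have h := coeffB_mul_radB p hm
  rw [cos_eq_one_sub_sinc] at h
  rw [corrA]
  linear_combination coeffB p m * radA_add_radB hm - h

theorem corrB_spec (p : ℕ) {m : E4} (hm : m ∈ Metric.sphere (0 : E4) 1) :
    radB m * corrB p m = (-1) ^ p * coeffA p m - 1 := by
  have h := coeffA_mul_radA p m
  have h1 := cos_freq_mul p (radB m)
  have h2 : 1 - radB m = radA m := by linarith [radA_add_radB hm]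
  rw [h2, ← h, cos_eq_one_sub_sinc] at h1
  rw [corrB]
  linear_combination ((-1) ^ p * coeffA p m) * radA_add_radB hm + h1

theorem coeff_sq (p : ℕ) {m : E4} (hm : m ∈ Metric.sphere (0 : E4) 1) :
    (coeffA p m * radA m) ^ 2 + (coeffB p m * radB m) ^ 2 = 1 := by
  rw [coeffA_mul_radA, coeffB_mul_radB p hm, Real.sin_sq_add_cos_sq]

theorem cutForm_apply (p : ℕ) (m x : E4) : 2 * Real.pi * cutForm p m x =
    coeffA p m * (m 0 * x 1 - m 1 * x 0) + coeffB p m * (m 2 * x 3 - m 3 * x 2) := by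
  have h : cutForm p m x =
      freq p / (2 * Real.pi) * Real.sinc (freq p * (m 0 ^ 2 + m 1 ^ 2)) *
          (m 0 * x 1 - m 1 * x 0) +
        (-1) ^ p * (freq p / (2 * Real.pi)) * Real.sinc (freq p * (m 2 ^ 2 + m 3 ^ 2)) *
          (m 2 * x 3 - m 3 * x 2) := rfl
  rw [h, coeffA, coeffB, radA, radB]
  have := Real.pi_ne_zero
  field_simp

theorem inner_E4 (m x : E4) :
    inner ℝ m x = m 0 * x 0 + m 1 * x 1 + m 2 * x 2 + m 3 * x 3 := by
  rw [PiLp.inner_apply, Fin.sum_univ_four]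
  simp only [RCLike.inner_apply, conj_trivial]
  ring

/-- The real part of `w̄₁ w̄₂` for even `p`, of `w̄₁ w₂` for odd `p`. -/
noncomputable def frameRe (p : ℕ) (m : E4) : ℝ := m 0 * m 2 - (-1) ^ p * (m 1 * m 3)

/-- The imaginary part of `w̄₁ w̄₂` for even `p`, of `w̄₁ w₂` for odd `p`. -/
noncomputable def frameIm (p : ℕ) (m : E4) : ℝ := -(m 1 * m 2 + (-1) ^ p * (m 0 * m 3))

/-- The first vector field of the frame. -/
noncomputable def frame₁ (p : ℕ) (m : E4) : E4 :=
  !₂[m 2 - corrA p m * frameIm p m * m 1,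
    -((-1) ^ p * m 3) + corrA p m * frameIm p m * m 0,
    -m 0 + (-1) ^ p * (corrB p m * frameIm p m * m 3),
    (-1) ^ p * m 1 - (-1) ^ p * (corrB p m * frameIm p m * m 2)]

/-- The second vector field of the frame. -/
noncomputable def frame₂ (p : ℕ) (m : E4) : E4 :=
  !₂[(-1) ^ p * m 3 - corrA p m * frameRe p m * m 1,
    m 2 + corrA p m * frameRe p m * m 0,
    -m 1 + (-1) ^ p * (corrB p m * frameRe p m * m 3),
    -((-1) ^ p * m 0) - (-1) ^ p * (corrB p m * frameRe p m * m 2)]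

theorem inner_frame₁ (p : ℕ) (m x : E4) : inner ℝ (frame₁ p m) x =
    (m 2 - corrA p m * frameIm p m * m 1) * x 0 +
    (-((-1) ^ p * m 3) + corrA p m * frameIm p m * m 0) * x 1 +
    (-m 0 + (-1) ^ p * (corrB p m * frameIm p m * m 3)) * x 2 +
    ((-1) ^ p * m 1 - (-1) ^ p * (corrB p m * frameIm p m * m 2)) * x 3 :=
  inner_E4 _ _

theorem inner_frame₂ (p : ℕ) (m x : E4) : inner ℝ (frame₂ p m) x =
    ((-1) ^ p * m 3 - corrA p m * frameRe p m * m 1) * x 0 +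
    (m 2 + corrA p m * frameRe p m * m 0) * x 1 +
    (-m 1 + (-1) ^ p * (corrB p m * frameRe p m * m 3)) * x 2 +
    (-((-1) ^ p * m 0) - (-1) ^ p * (corrB p m * frameRe p m * m 2)) * x 3 :=
  inner_E4 _ _

/-! ### Smoothness of the frame. -/

theorem contDiff_coord (i : Fin 4) : ContDiff ℝ ∞ fun m : E4 => m i :=
  (coord i).contDiff

theorem contDiff_radA : ContDiff ℝ ∞ radA :=
  ((contDiff_coord 0).pow 2).add ((contDiff_coord 1).pow 2)

theorem contDiff_radB : ContDiff ℝ ∞ radB :=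
  ((contDiff_coord 2).pow 2).add ((contDiff_coord 3).pow 2)

theorem contDiff_corrA (p : ℕ) : ContDiff ℝ ∞ (corrA p) := by
  have hA := contDiff_radA
  have hB := contDiff_radB
  refine ContDiff.sub ?_ ?_
  · exact contDiff_const.mul (contDiff_const.mul (contDiff_sinc.comp (contDiff_const.mul hB)))
  · exact ((contDiff_const.mul hA).div_const 2).mul
      ((contDiff_sinc.comp ((contDiff_const.mul hA).div_const 2)).pow 2)

theorem contDiff_corrB (p : ℕ) : ContDiff ℝ ∞ (corrB p) := by
  have hA := contDiff_radA
  have hB := contDiff_radB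
  refine ContDiff.sub ?_ ?_
  · exact contDiff_const.mul (contDiff_const.mul (contDiff_sinc.comp (contDiff_const.mul hA)))
  · exact ((contDiff_const.mul hB).div_const 2).mul
      ((contDiff_sinc.comp ((contDiff_const.mul hB).div_const 2)).pow 2)

theorem contDiff_frameRe (p : ℕ) : ContDiff ℝ ∞ (frameRe p) :=
  ((contDiff_coord 0).mul (contDiff_coord 2)).sub
    (contDiff_const.mul ((contDiff_coord 1).mul (contDiff_coord 3)))

theorem contDiff_frameIm (p : ℕ) : ContDiff ℝ ∞ (frameIm p) :=
  (((contDiff_coord 1).mul (contDiff_coord 2)).add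
    (contDiff_const.mul ((contDiff_coord 0).mul (contDiff_coord 3)))).neg

theorem contDiff_frame₁ (p : ℕ) : ContDiff ℝ ∞ (frame₁ p) := by
  have hA := (contDiff_corrA p).mul (contDiff_frameIm p)
  have hB := (contDiff_corrB p).mul (contDiff_frameIm p)
  have c := contDiff_coord
  rw [contDiff_euclidean]
  intro i
  fin_cases i
  · exact (c 2).sub (hA.mul (c 1))
  · exact ((contDiff_const.mul (c 3)).neg).add (hA.mul (c 0))
  · exact (c 0).neg.add (contDiff_const.mul (hB.mul (c 3)))
  · exact (contDiff_const.mul (c 1)).sub (contDiff_const.mul (hB.mul (c 2)))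

theorem contDiff_frame₂ (p : ℕ) : ContDiff ℝ ∞ (frame₂ p) := by
  have hA := (contDiff_corrA p).mul (contDiff_frameRe p)
  have hB := (contDiff_corrB p).mul (contDiff_frameRe p)
  have c := contDiff_coord
  rw [contDiff_euclidean]
  intro i
  fin_cases i
  · exact (contDiff_const.mul (c 3)).sub (hA.mul (c 1))
  · exact (c 2).add (hA.mul (c 0))
  · exact (c 1).neg.add (contDiff_const.mul (hB.mul (c 3)))
  · exact (contDiff_const.mul (c 0)).neg.sub (contDiff_const.mul (hB.mul (c 2)))

/-- Both radii lie in `[0, 1]`, so the sum is at least the one in `coeff_sq`, which is `1`. In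
particular the two coefficients have no common zero. -/
theorem coeff_sq_combination_pos (p : ℕ) {m : E4} (hm : m ∈ Metric.sphere (0 : E4) 1) :
    0 < coeffA p m ^ 2 * radA m + coeffB p m ^ 2 * radB m := by
  have h := coeff_sq p hm
  have h1 := radA_add_radB hm
  have h2 : 0 ≤ radA m := by unfold radA; positivity
  have h3 : 0 ≤ radB m := by unfold radB; positivity
  nlinarith [mul_nonneg (mul_nonneg (sq_nonneg (coeffA p m)) h2) h3,
    mul_nonneg (mul_nonneg (sq_nonneg (coeffB p m)) h3) h2]

theorem eq_zero_of_coords {m : E4} (h0 : m 0 = 0) (h1 : m 1 = 0) (h2 : m 2 = 0) (h3 : m 3 = 0) :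
    m = 0 := by
  ext i; fin_cases i
  exacts [h0, h1, h2, h3]

/-- At a zero the angular components `coeffB * frameIm` and `-coeffA * frameIm` vanish, hence so
does `frameIm`. The uncorrected field remains, and it vanishes only at the origin. -/
theorem frame₁_ne_zero (p : ℕ) {m : E4} (hm : m ∈ Metric.sphere (0 : E4) 1) :
    frame₁ p m ≠ 0 := by
  intro h
  have e0 : m 2 - corrA p m * frameIm p m * m 1 = 0 := congrArg (fun m : E4 => m 0) h
  have e1 : -((-1) ^ p * m 3) + corrA p m * frameIm p m * m 0 = 0 :=
    congrArg (fun m : E4 => m 1) h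
  have e2 : -m 0 + (-1) ^ p * (corrB p m * frameIm p m * m 3) = 0 :=
    congrArg (fun m : E4 => m 2) h
  have e3 : (-1) ^ p * m 1 - (-1) ^ p * (corrB p m * frameIm p m * m 2) = 0 :=
    congrArg (fun m : E4 => m 3) h
  have hA := corrA_spec p hm
  have hB := corrB_spec p hm
  have hn := neg_one_pow_mul_self p
  have hW : frameIm p m = 0 := by
    have ha : coeffB p m * frameIm p m = 0 := by
      have : frameIm p m + radA m * corrA p m * frameIm p m = 0 := by
        conv_lhs => enter [1]; rw [frameIm]
        rw [radA]
        linear_combination m 0 * e1 - m 1 * e0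
      linear_combination this - frameIm p m * hA
    have hb : coeffA p m * frameIm p m = 0 := by
      have : (-1) ^ p * frameIm p m + (-1) ^ p * (radB m * corrB p m * frameIm p m) = 0 := by
        conv_lhs => enter [1]; rw [frameIm]
        rw [radB]
        linear_combination m 3 * e2 - m 2 * e3 - (m 0 * m 3) * hn
      linear_combination this - (-1) ^ p * frameIm p m * hB - (coeffA p m * frameIm p m) * hn
    have hpos := coeff_sq_combination_pos p hm
    by_contra hne
    rw [(mul_eq_zero.1 ha).resolve_right hne, (mul_eq_zero.1 hb).resolve_right hne] at hpos
    simp at hpos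
  rw [hW] at e0 e1 e2 e3
  have hn0 : ((-1 : ℝ) ^ p) ≠ 0 := by intro h0; rw [h0] at hn; simp at hn
  have : m = 0 := by
    refine eq_zero_of_coords (by linarith) ?_ (by linarith) ?_
    · exact (mul_eq_zero.1 (by linarith : (-1 : ℝ) ^ p * m 1 = 0)).resolve_left hn0
    · exact (mul_eq_zero.1 (by linarith : (-1 : ℝ) ^ p * m 3 = 0)).resolve_left hn0
  rw [this] at hm
  simp at hm

theorem inner_self_frame₁ (p : ℕ) (m : E4) : inner ℝ m (frame₁ p m) = 0 := by
  rw [real_inner_comm, inner_frame₁]; ring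

/-- The corrections are designed to make the angular components in `w₁` and `w₂` equal to `coeffB *
frameIm` and `-coeffA * frameIm`, so the two terms of the form cancel. -/
theorem cutForm_frame₁ (p : ℕ) {m : E4} (hm : m ∈ Metric.sphere (0 : E4) 1) :
    cutForm p m (frame₁ p m) = 0 := by
  have h := cutForm_apply p m (frame₁ p m)
  have hA := corrA_spec p hm
  have hB := corrB_spec p hm
  have hn := neg_one_pow_mul_self p
  have h1 : m 0 * frame₁ p m 1 - m 1 * frame₁ p m 0 = coeffB p m * frameIm p m := by
    have : m 0 * frame₁ p m 1 - m 1 * frame₁ p m 0 =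
        frameIm p m + radA m * corrA p m * frameIm p m := by
      conv_rhs => enter [1]; rw [frameIm]
      simp [frame₁, radA]
      ring
    rw [this, hA]; ring
  have h2 : m 2 * frame₁ p m 3 - m 3 * frame₁ p m 2 = -(coeffA p m * frameIm p m) := by
    have : m 2 * frame₁ p m 3 - m 3 * frame₁ p m 2 =
        -((-1) ^ p * frameIm p m) - (-1) ^ p * (radB m * corrB p m * frameIm p m) := by
      conv_rhs => enter [1]; rw [frameIm]
      simp [frame₁, radB]
      linear_combination (-(m 0 * m 3)) * hn
    rw [this, hB]
    linear_combination (-(coeffA p m * frameIm p m)) * hn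
  rw [h1, h2] at h
  have h3 : 2 * Real.pi * cutForm p m (frame₁ p m) = 0 := by rw [h]; ring
  exact (mul_eq_zero.1 h3).resolve_left (by positivity)

instance : Fact (Module.finrank ℝ E4 = 3 + 1) := ⟨finrank_euclideanSpace_fin⟩

theorem isNonvanishingSection_frame₁ (p : ℕ) :
    IsNonvanishingSection (cutForm p) fun m => frame₁ p m :=
  ⟨(contDiff_frame₁ p).contMDiff.comp contMDiff_coe_sphere,
    fun m => ⟨inner_self_frame₁ p m, cutForm_frame₁ p m.2, frame₁_ne_zero p m.2⟩⟩

/-- Rotating the frame by `frameRe` and `frameIm` separates directions: `frameRe * frame₁ - frameIm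
* frame₂` is radial, since the corrections cancel, and `frameIm * frame₁ + frameRe * frame₂` is
angular. -/
theorem inner_frame_combination (p : ℕ) {m x : E4} (hm : m ∈ Metric.sphere (0 : E4) 1)
    (h1 : inner ℝ (frame₁ p m) x = 0) (h2 : inner ℝ (frame₂ p m) x = 0) :
    radB m * (m 0 * x 0 + m 1 * x 1) - radA m * (m 2 * x 2 + m 3 * x 3) = 0 ∧
      coeffB p m * radB m * (m 0 * x 1 - m 1 * x 0) -
        coeffA p m * radA m * (m 2 * x 3 - m 3 * x 2) = 0 := by
  have hA := corrA_spec p hm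
  have hB := corrB_spec p hm
  have hn := neg_one_pow_mul_self p
  rw [inner_frame₁] at h1
  rw [inner_frame₂] at h2
  have f1 : frameRe p m = m 0 * m 2 - (-1) ^ p * (m 1 * m 3) := rfl
  have f2 : frameIm p m = -(m 1 * m 2 + (-1) ^ p * (m 0 * m 3)) := rfl
  have f3 : radA m = m 0 ^ 2 + m 1 ^ 2 := rfl
  have f4 : radB m = m 2 ^ 2 + m 3 ^ 2 := rfl
  have hA' : coeffB p m = 1 + radA m * corrA p m := by linear_combination - hA
  have hB' : coeffA p m = (-1) ^ p * (1 + radB m * corrB p m) := by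
    linear_combination - (-1) ^ p * hB - coeffA p m * hn
  rw [hA', hB']
  rcases neg_one_pow_eq_or ℝ p with h | h <;> rw [h] at f1 f2 h1 h2 ⊢ <;>
    rw [f1] at h2 <;> rw [f2] at h1 <;> rw [f3, f4] <;> constructor
  · linear_combination (m 0 * m 2 - m 1 * m 3) * h1 + (m 1 * m 2 + m 0 * m 3) * h2
  · linear_combination -(m 1 * m 2 + m 0 * m 3) * h1 + (m 0 * m 2 - m 1 * m 3) * h2
  · linear_combination (m 0 * m 2 + m 1 * m 3) * h1 + (m 1 * m 2 - m 0 * m 3) * h2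
  · linear_combination -(m 1 * m 2 - m 0 * m 3) * h1 + (m 0 * m 2 + m 1 * m 3) * h2

theorem eq_zero_of_sq_add_sq {a b : ℝ} (h : a ^ 2 + b ^ 2 = 0) : a = 0 ∧ b = 0 := by
  rwa [add_eq_zero_iff_of_nonneg (sq_nonneg a) (sq_nonneg b), sq_eq_zero_iff, sq_eq_zero_iff] at h

/-- The pairing with the frame is injective on the contact plane, so a nonvanishing section has a
nonvanishing coordinate function. The rotated frame degenerates where `w₁ w₂ = 0`, so on the two
circles the original frame is used. -/
theorem eq_zero_of_inner_frame (p : ℕ) {m x : E4} (hm : m ∈ Metric.sphere (0 : E4) 1)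
    (hx : inner ℝ m x = 0) (hα : cutForm p m x = 0) (h1 : inner ℝ (frame₁ p m) x = 0)
    (h2 : inner ℝ (frame₂ p m) x = 0) : x = 0 := by
  have hn := neg_one_pow_mul_self p
  have hz := radA_add_radB hm
  have hpos := coeff_sq_combination_pos p hm
  have hα' := cutForm_apply p m x
  rw [hα, mul_zero] at hα'
  rw [inner_E4] at hx
  obtain ⟨e1, e2⟩ := inner_frame_combination p hm h1 h2
  have hp : (m 0 * x 0 + m 1 * x 1) = 0 := by
    linear_combination e1 + radA m * hx - (m 0 * x 0 + m 1 * x 1) * hz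
  have hp' : m 2 * x 2 + m 3 * x 3 = 0 := by linarith
  -- The form and the angular relation are two linear equations for the angular components, with the
  -- positive quantity `hpos` as determinant.
  have hq1' : (m 0 * x 1 - m 1 * x 0) = 0 := by
    refine (mul_eq_zero.1 (?_ :
      (coeffA p m ^ 2 * radA m + coeffB p m ^ 2 * radB m) * (m 0 * x 1 - m 1 * x 0) = 0)).resolve_left hpos.ne'
    linear_combination coeffB p m * e2 - coeffA p m * radA m * hα'
  have hq2' : (m 2 * x 3 - m 3 * x 2) = 0 := by
    refine (mul_eq_zero.1 (?_ :
      (coeffA p m ^ 2 * radA m + coeffB p m ^ 2 * radB m) * (m 2 * x 3 - m 3 * x 2) = 0)).resolve_left hpos.ne'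
    linear_combination - coeffA p m * e2 - coeffB p m * radB m * hα'
  -- `w̄₁ x₁ = 0` and `w̄₂ x₂ = 0`
  have k0 : radA m * x 0 = 0 := by rw [radA]; linear_combination m 0 * hp - m 1 * hq1'
  have k1 : radA m * x 1 = 0 := by rw [radA]; linear_combination m 1 * hp + m 0 * hq1'
  have k2 : radB m * x 2 = 0 := by rw [radB]; linear_combination m 2 * hp' - m 3 * hq2'
  have k3 : radB m * x 3 = 0 := by rw [radB]; linear_combination m 3 * hp' + m 2 * hq2'
  by_cases hA0 : radA m = 0
  · obtain ⟨m0, m1⟩ := eq_zero_of_sq_add_sq hA0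
    have hB1 : radB m = 1 := by linarith
    rw [hB1, one_mul] at k2 k3
    rw [inner_frame₁] at h1
    rw [inner_frame₂] at h2
    rw [m0, m1, k2, k3] at h1 h2
    rw [radB] at hB1
    refine eq_zero_of_coords ?_ ?_ k2 k3
    · linear_combination m 2 * h1 + (-1) ^ p * m 3 * h2 - x 0 * hB1 - m 3 ^ 2 * x 0 * hn
    · linear_combination m 2 * h2 - (-1) ^ p * m 3 * h1 - x 1 * hB1 - m 3 ^ 2 * x 1 * hn
  have x0 := (mul_eq_zero.1 k0).resolve_left hA0
  have x1 := (mul_eq_zero.1 k1).resolve_left hA0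
  by_cases hB0 : radB m = 0
  · obtain ⟨m2, m3⟩ := eq_zero_of_sq_add_sq hB0
    have hA1 : radA m = 1 := by linarith
    rw [inner_frame₁] at h1
    rw [inner_frame₂] at h2
    rw [m2, m3, x0, x1] at h1 h2
    rw [radA] at hA1
    refine eq_zero_of_coords x0 x1 ?_ ?_
    · linear_combination -m 0 * h1 - m 1 * h2 - x 2 * hA1
    · linear_combination (-1) ^ p * m 1 * h1 - (-1) ^ p * m 0 * h2 - x 3 * hA1 -
        (m 0 ^ 2 + m 1 ^ 2) * x 3 * hn
  · exact eq_zero_of_coords x0 x1 ((mul_eq_zero.1 k2).resolve_left hB0)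
      ((mul_eq_zero.1 k3).resolve_left hB0)

/-! ### The circle `C₀` -/

theorem coe_toCircle (t : ℝ) : ((AddCircle.toCircle (t : UnitAddCircle) : Circle) : ℂ) =
    Complex.exp (2 * Real.pi * t * Complex.I) := by
  rw [AddCircle.toCircle_apply_mk, Circle.coe_exp]
  push_cast
  rw [div_one]

theorem coe_C0 (t : ℝ) : (C0 t : E4) = point 0 (Complex.exp (2 * Real.pi * t * Complex.I)) := by
  rw [← coe_toCircle]
  ext i
  fin_cases i <;> simp [C0, cutMap, cutFun]

theorem coe_C1 (t : ℝ) : (C1 t : E4) = point (Complex.exp (2 * Real.pi * t * Complex.I)) 0 := by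
  rw [← coe_toCircle]
  ext i
  fin_cases i <;> simp [C1, cutMap, cutFun]

theorem ambient_C0 :
    ambient C0 = fun t : ℝ => point 0 (Complex.exp (2 * Real.pi * t * Complex.I)) :=
  funext coe_C0

theorem deriv_ambient_C0 (t : ℝ) : deriv (ambient C0) t =
    point 0 (Complex.exp (2 * Real.pi * t * Complex.I) * (2 * Real.pi * Complex.I)) := by
  rw [ambient_C0]
  exact (hasDerivAt_point (hasDerivAt_const t (0 : ℂ)) (hasDerivAt_exp_circle t)).deriv

theorem isKnot_C0 : IsKnot C0 := by
  refine ⟨?_, fun t => ?_, fun s hs t ht h => ?_, fun t h => ?_⟩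
  · rw [ambient_C0]
    exact contDiff_point contDiff_const contDiff_exp_circle
  · rw [C0, C0, AddCircle.coe_add_period]
  · have h1 := ((cutMap_eq_iff _ _ _ _ _ _).1 h).2.2.resolve_right zero_ne_one
    have hI : ∀ r : ℝ, r ∈ Set.Ico (0 : ℝ) 1 → r ∈ Set.Ico (0 : ℝ) (0 + 1) := by simp
    exact (AddCircle.coe_eq_coe_iff_of_mem_Ico (hI s hs) (hI t ht)).1 h1
  · rw [deriv_ambient_C0] at h
    have h0 : point 0 (Complex.exp (2 * Real.pi * t * Complex.I) * (2 * Real.pi * Complex.I)) =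
        point 0 0 := by
      rw [h]; ext i; fin_cases i <;> simp
    have := (point_inj.1 h0).2
    simp [Complex.exp_ne_zero, Real.pi_ne_zero] at this

/-- The round hemisphere bounded by `C₀`. -/
noncomputable def hemisphere : ℂ → E4 := twistedDisc fun _ => 0

theorem hemisphere_apply (w : ℂ) : hemisphere w =
    point ((1 - ‖w‖ ^ 2) / (1 + ‖w‖ ^ 2) : ℝ) ((2 / (1 + ‖w‖ ^ 2) : ℝ) * w) := by
  simp [hemisphere, twistedDisc, radialExtension]

/-- Stereographic projection, a left inverse of `hemisphere`. -/
noncomputable def stereo (m : E4) : ℂ := (⟨m 2, m 3⟩ : ℂ) / ((1 + m 0 : ℝ) : ℂ)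

theorem stereo_hemisphere (w : ℂ) : stereo (hemisphere w) = w := by
  have h : (1 + ‖w‖ ^ 2) ≠ 0 := one_add_norm_sq_ne_zero w
  rw [hemisphere_apply]
  have h1 : (⟨point ((1 - ‖w‖ ^ 2) / (1 + ‖w‖ ^ 2) : ℝ) ((2 / (1 + ‖w‖ ^ 2) : ℝ) * w) 2,
      point ((1 - ‖w‖ ^ 2) / (1 + ‖w‖ ^ 2) : ℝ) ((2 / (1 + ‖w‖ ^ 2) : ℝ) * w) 3⟩ : ℂ) =
      (2 / (1 + ‖w‖ ^ 2) : ℝ) * w := rfl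
  have h2 : 1 + point ((1 - ‖w‖ ^ 2) / (1 + ‖w‖ ^ 2) : ℝ) ((2 / (1 + ‖w‖ ^ 2) : ℝ) * w) 0 =
      2 / (1 + ‖w‖ ^ 2) := by
    rw [point_zero, Complex.ofReal_re]
    field_simp
    ring
  rw [stereo, h1, h2, mul_div_cancel_left₀]
  rw [Complex.ofReal_ne_zero]
  positivity

theorem differentiableAt_stereo {m : E4} (hm : 1 + m 0 ≠ 0) : DifferentiableAt ℝ stereo m := by
  have h : stereo = fun m : E4 =>
      ((m 2 : ℂ) + (m 3 : ℂ) * Complex.I) / ((1 + m 0 : ℝ) : ℂ) := by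
    funext m
    rw [stereo, Complex.mk_eq_add_mul_I]
  have c : ∀ i, DifferentiableAt ℝ (fun m : E4 => m i) m :=
    fun i => ((contDiff_coord i).differentiable (by simp)).differentiableAt
  have c' : ∀ i, DifferentiableAt ℝ (fun m : E4 => (m i : ℂ)) m :=
    fun i => Complex.ofRealCLM.differentiableAt.comp m (c i)
  rw [h]
  have hd : DifferentiableAt ℝ (fun m : E4 => ((1 + m 0 : ℝ) : ℂ)) m :=
    Complex.ofRealCLM.differentiableAt.comp m ((c 0).const_add 1)
  have hn : DifferentiableAt ℝ (fun m : E4 => (m 2 : ℂ) + (m 3 : ℂ) * Complex.I) m :=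
    (c' 2).add ((c' 3).mul_const _)
  have hm' : ((1 + m 0 : ℝ) : ℂ) ≠ 0 := Complex.ofReal_ne_zero.2 hm
  exact hn.mul (hd.inv hm')

/-- The differentiable left inverse `stereo` yields injectivity at once and immersivity by the chain
rule. -/
theorem isUnknot_C0 : IsUnknot C0 := by
  refine ⟨isKnot_C0, hemisphere, ?_, ?_, fun w _ => ?_⟩
  · rw [ambient_C0]
    exact isDiscBoundedBy_twistedDisc contDiff_const
  · exact (Function.LeftInverse.injective stereo_hemisphere).injOn
  · have hF : HasFDerivAt hemisphere (fderiv ℝ hemisphere w) w :=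
      ((contDiff_twistedDisc contDiff_const).differentiable (by simp)).differentiableAt.hasFDerivAt
    have hS : DifferentiableAt ℝ stereo (hemisphere w) := by
      refine differentiableAt_stereo ?_
      rw [hemisphere_apply, point_zero, Complex.ofReal_re]
      have h := one_add_norm_sq_ne_zero w
      have h2 : 1 + (1 - ‖w‖ ^ 2) / (1 + ‖w‖ ^ 2) = 2 / (1 + ‖w‖ ^ 2) := by
        field_simp
        ring
      rw [h2]
      positivity
    have hc := hS.hasFDerivAt.comp w hF
    have hid : stereo ∘ hemisphere = id := funext stereo_hemisphere
    rw [hid] at hc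
    have := hc.unique (hasFDerivAt_id w)
    refine Function.LeftInverse.injective (g := fderiv ℝ stereo (hemisphere w)) fun x => ?_
    exact congrArg (fun A : ℂ →L[ℝ] ℂ => A x) this

/-! ### Transversality of `C₀` and contact sections along it. -/

theorem coeffB_C0 (p : ℕ) (t : ℝ) : coeffB p (C0 t) = 1 := by
  have h := corrA_spec p (C0 t).2
  have h0 : radA (C0 t : E4) = 0 := by simp [coe_C0, radA]
  rw [h0, zero_mul] at h
  linarith

theorem isTransverse_C0 (p : ℕ) : IsTransverse (cutForm p) C0 := by
  intro t h
  have h1 := cutForm_apply p (C0 t) (deriv (ambient C0) t)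
  have h2 := norm_exp_circle t
  rw [h, mul_zero, coeffB_C0, deriv_ambient_C0, coe_C0] at h1
  rw [← sq_eq_sq₀ (norm_nonneg _) zero_le_one, norm_sq_eq_re_im] at h2
  generalize Complex.exp (2 * Real.pi * t * Complex.I) = e at *
  simp at h1
  have h3 : 2 * Real.pi * (e.re ^ 2 + e.im ^ 2) = 0 := by linear_combination -h1
  rw [h2] at h3
  have := Real.pi_pos
  linarith

/-- The coordinates of a section of the contact structure along `C₀` in terms of the frame. -/
theorem section_C0 (p : ℕ) {v : S3 → E4} (hv : IsNonvanishingSection (cutForm p) v) (t : ℝ) :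
    v (C0 t) = point ((⟨inner ℝ (frame₁ p (C0 t)) (v (C0 t)),
        inner ℝ (frame₂ p (C0 t)) (v (C0 t))⟩ : ℂ) *
      Complex.exp (2 * Real.pi * (((-1) ^ (p + 1) : ℤ) * t) * Complex.I)) 0 := by
  obtain ⟨h1, h2, -⟩ := hv.2 (C0 t)
  have h3 := cutForm_apply p (C0 t) (v (C0 t))
  rw [h2, mul_zero, coeffB_C0] at h3
  have hm : (C0 t : E4) = point 0 (Complex.exp (2 * Real.pi * t * Complex.I)) := coe_C0 t
  -- The right side is `w̄₂` for even `p` and `w₂` for odd `p`, the first coordinate of `frame₁` on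
  -- `C₀`.
  have he : Complex.exp (2 * Real.pi * (((-1) ^ (p + 1) : ℤ) * t) * Complex.I) =
      ⟨(Complex.exp (2 * Real.pi * t * Complex.I)).re,
        -((-1) ^ p * (Complex.exp (2 * Real.pi * t * Complex.I)).im)⟩ := by
    have hexp : ∀ r : ℝ, Complex.exp (r * Complex.I) = ⟨Real.cos r, Real.sin r⟩ := fun r =>
      Complex.ext (Complex.exp_ofReal_mul_I_re r) (Complex.exp_ofReal_mul_I_im r)
    have h1 : (2 * Real.pi * (((-1) ^ (p + 1) : ℤ) * t) : ℂ) =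
        ((-((-1) ^ p * (2 * Real.pi * t)) : ℝ) : ℂ) := by
      push_cast; ring
    have h2 : (2 * Real.pi * t : ℂ) = ((2 * Real.pi * t : ℝ) : ℂ) := by push_cast; rfl
    rw [h1, h2, hexp, hexp]
    rcases neg_one_pow_eq_or ℝ p with h | h <;> rw [h] <;> simp
  have hsq := norm_exp_circle t
  rw [← sq_eq_sq₀ (norm_nonneg _) zero_le_one, norm_sq_eq_re_im, one_pow] at hsq
  have hn := neg_one_pow_mul_self p
  rw [he, inner_frame₁, inner_frame₂]
  -- Both factors are bilinear in `w₁`, `w₂`, so the corrections of the frame disappear where `w₁ =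
  -- 0`.
  have hU : frameRe p (C0 t) = 0 := by simp [frameRe, hm]
  have hW : frameIm p (C0 t) = 0 := by simp [frameIm, hm]
  rw [inner_E4] at h1
  rw [hU, hW]
  rw [hm] at h1 h3 ⊢
  generalize Complex.exp (2 * Real.pi * t * Complex.I) = e at *
  generalize v (C0 t) = x at *
  simp only [point_zero, point_one, point_two, point_three, Complex.zero_re, Complex.zero_im] at *
  ext i
  fin_cases i
  · simp
    linear_combination (-x 0) * hsq - e.im ^ 2 * x 0 * hn
  · simp
    linear_combination (-x 1) * hsq - e.im ^ 2 * x 1 * hn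
  · simp
    linear_combination (-x 2) * hsq + e.re * h1 + e.im * h3
  · simp
    linear_combination (-x 3) * hsq + e.im * h1 - e.re * h3

theorem contMDiff_hemisphere : ContMDiff 𝓘(ℝ, ℂ) (𝓡 3) ∞
    (Set.codRestrict hemisphere (Metric.sphere (0 : E4) 1) fun w =>
      twistedDisc_mem_sphere _ w) :=
  (contDiff_twistedDisc contDiff_const).contMDiff.codRestrict_sphere _

theorem hemisphere_circle (t : ℝ) :
    Set.codRestrict hemisphere (Metric.sphere (0 : E4) 1) (fun w => twistedDisc_mem_sphere _ w)
      (Complex.exp (2 * Real.pi * t * Complex.I)) = C0 t := by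
  apply Subtype.ext
  rw [coe_C0]
  exact (isDiscBoundedBy_twistedDisc (contDiff_const (c := (0 : ℝ)))).2.2 t

/-- Relative to the first factor of `ℂ²`, every section of the contact structure has winding number
`(-1)^(p+1)` along `C₀`. -/
theorem exists_log_section (p : ℕ) {v : S3 → E4} (hv : IsNonvanishingSection (cutForm p) v) :
    ∃ Λ : ℂ → ℂ, ContDiff ℝ ∞ Λ ∧ ∀ t : ℝ, v (C0 t) =
      point (Complex.exp (Λ (Complex.exp (2 * Real.pi * t * Complex.I))) *
        Complex.exp (2 * Real.pi * (((-1) ^ (p + 1) : ℤ) * t) * Complex.I)) 0 := by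
  set D : ℂ → S3 := Set.codRestrict hemisphere (Metric.sphere (0 : E4) 1) fun w =>
    twistedDisc_mem_sphere _ w with hD
  have hDs : ContDiff ℝ ∞ hemisphere := contDiff_twistedDisc contDiff_const
  have hvD : ContDiff ℝ ∞ fun w => v (D w) :=
    contMDiff_iff_contDiff.1 (hv.1.comp contMDiff_hemisphere)
  have h1 : ContDiff ℝ ∞ fun w => inner ℝ (frame₁ p (D w)) (v (D w)) :=
    ((contDiff_frame₁ p).comp hDs).inner ℝ hvD
  have h2 : ContDiff ℝ ∞ fun w => inner ℝ (frame₂ p (D w)) (v (D w)) :=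
    ((contDiff_frame₂ p).comp hDs).inner ℝ hvD
  set Q : ℂ → ℂ := fun w =>
    ⟨inner ℝ (frame₁ p (D w)) (v (D w)), inner ℝ (frame₂ p (D w)) (v (D w))⟩ with hQ
  have hQs : ContDiff ℝ ∞ Q := by
    have : Q = fun w => ((inner ℝ (frame₁ p (D w)) (v (D w)) : ℝ) : ℂ) +
        ((inner ℝ (frame₂ p (D w)) (v (D w)) : ℝ) : ℂ) * Complex.I := by
      funext w
      exact Complex.mk_eq_add_mul_I _ _
    rw [this]
    exact (Complex.ofRealCLM.contDiff.comp h1).add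
      ((Complex.ofRealCLM.contDiff.comp h2).mul contDiff_const)
  -- `Q` is defined and nonzero on the whole plane, because the hemisphere formula maps all of `ℂ`
  -- into the sphere.
  obtain ⟨Λ, hΛ, hexp⟩ := exists_contDiff_log hQs fun w hw => by
    obtain ⟨i1, i2, i3⟩ := hv.2 (D w)
    exact i3 (eq_zero_of_inner_frame p (D w).2 i1 i2 (congrArg Complex.re hw)
      (congrArg Complex.im hw))
  refine ⟨Λ, hΛ, fun t => ?_⟩
  rw [hexp, hQ]
  simp only
  rw [hD, hemisphere_circle]
  exact section_C0 p hv t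

theorem hasLinkingNumber_pushOff_C0 (p : ℕ) {v : S3 → E4}
    (hv : IsNonvanishingSection (cutForm p) v) :
    ∀ᶠ ε in nhdsWithin (0 : ℝ) (Set.Ioi 0),
      HasLinkingNumber (ambient C0) (pushOff C0 v ε) ((-1) ^ (p + 1)) := by
  obtain ⟨Λ, hΛ, hvΛ⟩ := exists_log_section p hv
  have hre : Continuous fun w => Real.exp (Λ w).re :=
    Real.continuous_exp.comp (Complex.continuous_re.comp hΛ.continuous)
  obtain ⟨M, hM⟩ := (isCompact_sphere (0 : ℂ) 1).exists_bound_of_continuousOn hre.continuousOn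
  set ρ : ℝ → ℝ := fun t => Real.exp (Λ (Complex.exp (2 * Real.pi * t * Complex.I))).re with hρ
  have hρ0 : ∀ t, 0 < ρ t := fun t => Real.exp_pos _
  have hρM : ∀ t, ρ t ≤ M := fun t => by
    have := hM (Complex.exp (2 * Real.pi * t * Complex.I)) (by
      rw [mem_sphere_zero_iff_norm, norm_exp_circle])
    exact (le_abs_self _).trans this
  have hM0 : 0 < M := (hρ0 0).trans_le (hρM 0)
  have hρs : ContDiff ℝ ∞ ρ :=
    (Complex.reCLM.contDiff.comp (hΛ.comp contDiff_exp_circle)).exp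
  -- With `M` bounding the length factor `ρ` on the circle, this range gives `ε ρ < 3/5`, the
  -- threshold for the outer annulus.
  filter_upwards [Ioo_mem_nhdsGT (by positivity : (0 : ℝ) < 3 / (5 * M))] with ε hε
  set n : ℝ → ℝ := fun t => √(1 + (ε * ρ t) ^ 2) with hn
  have hn1 : ∀ t, 1 ≤ n t := fun t => by
    rw [hn]; exact Real.one_le_sqrt.2 (by nlinarith [sq_nonneg (ε * ρ t)])
  have hn0 : ∀ t, 0 < n t := fun t => zero_lt_one.trans_le (hn1 t)
  have hnsq : ∀ t, n t ^ 2 = 1 + (ε * ρ t) ^ 2 := fun t => Real.sq_sqrt (by positivity)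
  have hns : DifferentiableAt ℝ n 0 := by
    have h1 : DifferentiableAt ℝ (fun t => 1 + (ε * ρ t) ^ 2) 0 :=
      (((hρs.differentiable (by simp)).differentiableAt.const_mul ε).pow 2).const_add 1
    exact h1.sqrt (by positivity)
  have hψ : DifferentiableAt ℝ (fun t => (n t)⁻¹) 0 := hns.fun_inv (hn0 0).ne'
  have hεM : ∀ t, ε * ρ t < 3 / 5 := fun t => by
    have h1 := hε.2
    rw [lt_div_iff₀ (by positivity)] at h1
    nlinarith [mul_le_mul_of_nonneg_left (hρM t) hε.1.le]
  have hερ : ∀ t, 0 < ε * ρ t := fun t => mul_pos hε.1 (hρ0 t)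
  -- Taking `Θ = Im Λ` lets the disc absorb the phase of the section; `Re Λ` only enters the
  -- distance from `C₀`.
  have hP : pushOff C0 v ε = twistedCurve ((-1) ^ (p + 1)) (fun w => (Λ w).im)
      (fun t => (n t)⁻¹ * (ε * ρ t)) (fun t => (n t)⁻¹) := by
    funext t
    have hsum : (C0 t : E4) + ε • v (C0 t) =
        point (((ε * ρ t : ℝ) : ℂ) * Complex.exp (((2 * Real.pi * (((-1) ^ (p + 1) : ℤ) * t) +
          (Λ (Complex.exp (2 * Real.pi * t * Complex.I))).im : ℝ) : ℂ) * Complex.I))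
          (Complex.exp (2 * Real.pi * t * Complex.I)) := by
      have hexp : Complex.exp (Λ (Complex.exp (2 * Real.pi * t * Complex.I))) *
          Complex.exp (2 * Real.pi * (((-1) ^ (p + 1) : ℤ) * t) * Complex.I) =
          (ρ t : ℂ) * Complex.exp (((2 * Real.pi * (((-1) ^ (p + 1) : ℤ) * t) +
          (Λ (Complex.exp (2 * Real.pi * t * Complex.I))).im : ℝ) : ℂ) * Complex.I) := by
        rw [hρ]
        simp only
        rw [Complex.ofReal_exp, ← Complex.exp_add, ← Complex.exp_add]
        congr 1
        conv_lhs => enter [1]; rw [← Complex.re_add_im (Λ _)]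
        push_cast
        ring
      have hadd : ∀ a b : ℂ, point 0 a + point b 0 = point b a := fun a b => by
        ext i; fin_cases i <;> simp
      rw [hvΛ, hexp, smul_point, coe_C0, mul_zero, hadd]
      congr 1
      push_cast
      ring
    have hnorm : ‖(C0 t : E4) + ε • v (C0 t)‖ = n t := by
      rw [← sq_eq_sq₀ (norm_nonneg _) (hn0 t).le, hsum, norm_sq_point, norm_mul,
        Complex.norm_exp_ofReal_mul_I, norm_exp_circle, mul_one, Complex.norm_real,
        Real.norm_eq_abs, sq_abs, hnsq]
      ring
    rw [pushOff, hnorm, hsum, smul_point, twistedCurve]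
    congr 1 <;> (push_cast; ring)
  rw [hP, ambient_C0]
  refine hasLinkingNumber_twistedCurve (neg_one_pow_eq_or ℤ (p + 1)) ?_ ?_ hψ
    (fun t => ?_) (fun t => ?_) (fun t => ?_) fun t => ?_
  · exact Complex.imCLM.contDiff.comp hΛ
  · exact hψ.mul ((hρs.differentiable (by simp)).differentiableAt.const_mul ε)
  · exact mul_pos (inv_pos.2 (hn0 t)) (hερ t)
  · exact (mul_le_of_le_one_left (hερ t).le (inv_le_one_of_one_le₀ (hn1 t))).trans_lt (hεM t)
  · exact inv_pos.2 (hn0 t)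
  · have := (hn0 t).ne'
    field_simp
    rw [hnsq]
    ring

theorem hasSelfLinkingNumber_C0 (p : ℕ) :
    HasSelfLinkingNumber (cutForm p) C0 ((-1) ^ (p + 1)) :=
  ⟨isKnot_C0, isTransverse_C0 p, ⟨_, isNonvanishingSection_frame₁ p⟩,
    fun _ hv => hasLinkingNumber_pushOff_C0 p hv⟩

/-! ### The symmetry exchanging the two circles -/

/-- The isometry `(w₁, w₂) ↦ (w₂, w₁)` of `ℂ²`. -/
noncomputable def swapIso : E4 ≃ₗᵢ[ℝ] E4 :=
  -- A shift by `2` modulo `4` exchanges the index pairs `(0, 1)` and `(2, 3)`.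
  LinearIsometryEquiv.piLpCongrLeft 2 ℝ ℝ (Equiv.addRight (2 : Fin 4))

theorem swapIso_apply (m : E4) (i : Fin 4) : swapIso m i = m (i - 2) := by
  simp [swapIso, LinearIsometryEquiv.piLpCongrLeft_apply, Equiv.piCongrLeft', sub_eq_add_neg]

@[simp] theorem swapIso_zero (m : E4) : swapIso m 0 = m 2 := swapIso_apply m 0
@[simp] theorem swapIso_one (m : E4) : swapIso m 1 = m 3 := swapIso_apply m 1
@[simp] theorem swapIso_two (m : E4) : swapIso m 2 = m 0 := swapIso_apply m 2
@[simp] theorem swapIso_three (m : E4) : swapIso m 3 = m 1 := swapIso_apply m 3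

theorem swapIso_point (a b : ℂ) : swapIso (point a b) = point b a := by
  ext i; fin_cases i <;> simp

@[simp] theorem swapIso_swapIso (m : E4) : swapIso (swapIso m) = m := by
  ext i; fin_cases i <;> simp

theorem swapIso_mem_sphere {m : E4} (hm : m ∈ Metric.sphere (0 : E4) 1) :
    swapIso m ∈ Metric.sphere (0 : E4) 1 := by
  rwa [mem_sphere_zero_iff_norm, swapIso.norm_map, ← mem_sphere_zero_iff_norm]

theorem swapIso_C0 (t : ℝ) : swapIso (C0 t) = C1 t := by
  rw [coe_C0, coe_C1, swapIso_point]

/-- The swap consists of two coordinate transpositions, so its determinant is `1`. -/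
theorem orientDet_swapIso (a b c d : E4) :
    orientDet (swapIso a) (swapIso b) (swapIso c) (swapIso d) = orientDet a b c d := by
  rw [orientDet, orientDet]
  simp [Matrix.det_succ_row_zero, Fin.sum_univ_succ, Fin.succAbove]
  ring

/-- Exchanging `z` and `1 - z` exchanges the two `sinc` coefficients up to the sign `(-1)^p`, so the
kernel is preserved. -/
theorem cutForm_swapIso (p : ℕ) (m x : E4) :
    cutForm p (swapIso m) (swapIso x) = (-1) ^ p * cutForm p m x := by
  have h1 := cutForm_apply p m x
  have h2 := cutForm_apply p (swapIso m) (swapIso x)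
  have hA : coeffA p (swapIso m) = (-1) ^ p * coeffB p m := by
    have hn := neg_one_pow_mul_self p
    have : radA (swapIso m) = radB m := by simp [radA, radB]
    rw [coeffA, coeffB, this, ← mul_assoc, hn, one_mul]
  have hB : coeffB p (swapIso m) = (-1) ^ p * coeffA p m := by
    have : radB (swapIso m) = radA m := by simp [radA, radB]
    rw [coeffA, coeffB, this]
  rw [hA, hB] at h2
  simp only [swapIso_zero, swapIso_one, swapIso_two, swapIso_three] at h2
  apply mul_left_cancel₀ (by positivity : 2 * Real.pi ≠ 0)
  linear_combination h2 - (-1) ^ p * h1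

/-! ### Transport of discs, linking numbers and sections by the swap. -/

theorem IsDiscBoundedBy.swap {F : ℂ → E4} {K : ℝ → E4} (h : IsDiscBoundedBy F K) :
    IsDiscBoundedBy (fun w => swapIso (F w)) fun t => swapIso (K t) :=
  ⟨swapIso.contDiff.comp h.1, fun w hw => swapIso_mem_sphere (h.2.1 w hw),
    fun t => congrArg swapIso (h.2.2 t)⟩

theorem fderiv_swapIso_comp (F : ℂ → E4) (w x : ℂ) :
    fderiv ℝ (fun w => swapIso (F w)) w x = swapIso (fderiv ℝ F w x) :=
  congrArg (fun A : ℂ →L[ℝ] E4 => A x)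
    (swapIso.toContinuousLinearEquiv.comp_fderiv (f := F) (x := w))

theorem deriv_swapIso_comp (K : ℝ → E4) (t : ℝ) :
    deriv (fun t => swapIso (K t)) t = swapIso (deriv K t) := by
  rw [← fderiv_apply_one_eq_deriv, ← fderiv_apply_one_eq_deriv]
  exact congrArg (fun A : ℝ →L[ℝ] E4 => A 1)
    (swapIso.toContinuousLinearEquiv.comp_fderiv (f := K) (x := t))

theorem HasLinkingNumber.swap {K L : ℝ → E4} {n : ℤ} (h : HasLinkingNumber K L n) :
    HasLinkingNumber (fun t => swapIso (K t)) (fun t => swapIso (L t)) n := by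
  obtain ⟨hne, F, hF, I, hI, hdet, hsum⟩ := h
  refine ⟨fun s t he => hne s t (swapIso.injective he), _, hF.swap, I, fun w t => ?_, ?_, ?_⟩
  · rw [hI, swapIso.injective.eq_iff]
  all_goals simp only [fderiv_swapIso_comp, deriv_swapIso_comp, orientDet_swapIso]
  · exact hdet
  · exact hsum

theorem ambient_C1 : ambient C1 = fun t => swapIso (ambient C0 t) :=
  funext fun t => (swapIso_C0 t).symm

theorem isKnot_C1 : IsKnot C1 := by
  obtain ⟨h1, h2, h3, h4⟩ := isKnot_C0
  have hiff : ∀ s t, C1 s = C1 t ↔ C0 s = C0 t := fun s t => by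
    rw [Subtype.ext_iff, Subtype.ext_iff, ← swapIso_C0, ← swapIso_C0, swapIso.injective.eq_iff]
  refine ⟨?_, fun t => (hiff _ _).2 (h2 t), fun s hs t ht h => h3 hs ht ((hiff s t).1 h),
    fun t => ?_⟩
  · rw [ambient_C1]
    exact swapIso.contDiff.comp h1
  · rw [ambient_C1, deriv_swapIso_comp, Ne, map_eq_zero_iff _ swapIso.injective]
    exact h4 t

theorem isUnknot_C1 : IsUnknot C1 := by
  obtain ⟨-, F, hF, hinj, himm⟩ := isUnknot_C0
  refine ⟨isKnot_C1, _, ?_, fun w hw w' hw' h => hinj hw hw' (swapIso.injective h),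
    fun w hw x y h => himm w hw (swapIso.injective ?_)⟩
  · rw [ambient_C1]
    exact hF.swap
  · rwa [fderiv_swapIso_comp, fderiv_swapIso_comp] at h

/-- The restriction of `swapIso` to the sphere. -/
noncomputable def swapSphere (m : S3) : S3 := ⟨swapIso m, swapIso_mem_sphere m.2⟩

theorem contMDiff_swapSphere : ContMDiff (𝓡 3) (𝓡 3) ∞ swapSphere :=
  (swapIso.contDiff.contMDiff.comp contMDiff_coe_sphere).codRestrict_sphere
    fun m => swapIso_mem_sphere m.2

theorem IsNonvanishingSection.swap {p : ℕ} {v : S3 → E4}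
    (hv : IsNonvanishingSection (cutForm p) v) :
    IsNonvanishingSection (cutForm p) fun m => swapIso (v (swapSphere m)) := by
  refine ⟨swapIso.contDiff.contMDiff.comp (hv.1.comp contMDiff_swapSphere), fun m => ?_⟩
  obtain ⟨h1, h2, h3⟩ := hv.2 (swapSphere m)
  have hm : (m : E4) = swapIso (swapSphere m) := (swapIso_swapIso m).symm
  refine ⟨?_, ?_, fun h => h3 (swapIso.injective (h.trans (map_zero swapIso).symm))⟩
  · rw [hm, swapIso.inner_map_map, h1]
  · rw [hm, cutForm_swapIso, h2, mul_zero]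

theorem pushOff_C1 (v : S3 → E4) (ε : ℝ) : pushOff C1 v ε =
    fun t => swapIso (pushOff C0 (fun m => swapIso (v (swapSphere m))) ε t) := by
  funext t
  have h : swapSphere (C0 t) = C1 t := Subtype.ext (swapIso_C0 t)
  have h1 : (C1 t : E4) + ε • v (C1 t) =
      swapIso ((C0 t : E4) + ε • swapIso (v (swapSphere (C0 t)))) := by
    rw [map_add, map_smul, swapIso_swapIso, swapIso_C0, h]
  rw [pushOff, pushOff, h1, swapIso.norm_map, map_smul]

/-- A section `v` near `C₁` is pulled back to a section near `C₀`; the result there holds for every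
section, and linking numbers are invariant under the swap. -/
theorem hasSelfLinkingNumber_C1 (p : ℕ) :
    HasSelfLinkingNumber (cutForm p) C1 ((-1) ^ (p + 1)) := by
  refine ⟨isKnot_C1, fun t => ?_, ⟨_, isNonvanishingSection_frame₁ p⟩, fun v hv => ?_⟩
  · rw [ambient_C1, deriv_swapIso_comp, ← swapIso_C0, cutForm_swapIso]
    exact mul_ne_zero (pow_ne_zero _ (by norm_num)) (isTransverse_C0 p t)
  · filter_upwards [hasLinkingNumber_pushOff_C0 p hv.swap] with ε hε
    rw [ambient_C1, pushOff_C1]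
    exact hε.swap

end ContactCut

/-- For every `p`, the circles `C₀` and `C₁` are unknots in `S³` transverse to the contact
structure `ker α_p`, with self-linking number `(-1)^(p+1)`. -/
theorem lemma6p4 (p : ℕ) :
    (ContactCut.IsUnknot ContactCut.C0 ∧
      ContactCut.HasSelfLinkingNumber (ContactCut.cutForm p) ContactCut.C0 ((-1) ^ (p + 1))) ∧
    (ContactCut.IsUnknot ContactCut.C1 ∧
      ContactCut.HasSelfLinkingNumber (ContactCut.cutForm p) ContactCut.C1 ((-1) ^ (p + 1))) :=
  ⟨⟨ContactCut.isUnknot_C0, ContactCut.hasSelfLinkingNumber_C0 p⟩,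
    ContactCut.isUnknot_C1, ContactCut.hasSelfLinkingNumber_C1 p⟩
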